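/- Corollary 4.2. Let $a_+,a_-\in\mathbb C$ with $\operatorname{Re}a_\pm>0$, and put $a=(a_++a_-)/2$, $q_\pm=e^{-\pi a_\pm}$, $$R_\delta(z)=\prod_{k\ge1}(1-q_\delta^{2k-1}e^{2i\pi z})(1-q_\delta^{2k-1}e^{-2i\pi z})\quad(\delta=+,-),\qquad G(z)=\prod_{m,n\ge1}\frac{1-q_+^{2m-1}q_-^{2n-1}e^{-2i\pi z}}{1-q_+^{2m-1}q_-^{2n-1}e^{2i\pi z}},$$ $$K(\gamma;z,y)=G(z+y-\gamma)\,G(z-y-\gamma)\,G(-z+y-\gamma)\,G(-z-y-\gamma).$$ For $l\in\mathbb C^4$ and $\delta=+,-$ let $A_{R,\delta}(l;z)$ be the difference operator $$(A_{R,\delta}(l;z)F)(z)=f_\delta(l;z)F(z+\tfrac{i}{2}a_{-\delta})+f_\delta(l;-z)F(z-\tfrac{i}{2}a_{-\delta}),\qquad f_\delta(l;z)=\frac{\prod_{n=1}^4R_\delta(z+l_n+ia_{-\delta}/4)}{R_\delta(2z-ia_\delta/2)}.$$ Let $\kappa=(1,1,1,1)$, let $\langle\cdot,\cdot\rangle$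 be the standard bilinear form on $\mathbb C^4$, and let $\phi_1(l)=-l+\langle\kappa,l\rangle\kappa/2$ and $\phi_2(l)=\phi_1(l)+\kappa/2$. (1) Let $l\in\mathbb C^4$, and let $\hat\gamma\in\mathbb C$ satisfy $2\hat\gamma=2ia+\langle\kappa,l\rangle+m$ with $m\in\mathbb Z$. Put $K_1(z,y)=K(\hat\gamma;z,y)$ and $K_2(z,y)=K(\hat\gamma+\tfrac12;z,y)$. If $m$ is even, then $$A_{R,\delta}(l;z)K_j(z,y)=A_{R,\delta}(\phi_j(l);y)K_j(z,y),\qquad \delta=+,-,\ \ j=1,2,$$ as an identity of meromorphic functions of $(z,y)$, valid at every point at which all coefficients and all factors $G$ that occur are regular. If $m$ is odd, the same holds with $\phi_1$ and $\phi_2$ interchanged. (2) Let $\mathcal M_e$ be the space of even meromorphic functions on $\mathbb C$. For $\mu\in\mathbb C^*$ let $\mathcal D_\delta(\mu)$ (the representation $\mathcal D(\mu)$ of the Sklyanin algebra $\mathcal S_\delta$) be the unital algebra of operators on $\mathcal M_e$ generated by all $A_{R,\delta}(l;z)$ with $\exp(-2\pi i(\langle\kappa,l\rangle+2ia))=\mu$.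 Let $s\in\mathbb C$ and $\mu=\exp(-2\pi i(s+2ia))$. Then for $\delta=+,-$ and $j=1,2$ there is a linear bijection $\Phi_j$ of $\mathcal D_\delta(\mu)$ with $\Phi_j(1)=1$, $\Phi_j(XY)=\Phi_j(Y)\Phi_j(X)$ and $\Phi_j(\Phi_j(X))=X$ for all $X,Y\in\mathcal D_\delta(\mu)$, and with $\Phi_j(A_{R,\delta}(l;z))=A_{R,\delta}(\phi_j(l);z)$ for every $l\in\mathbb C^4$ with $\langle\kappa,l\rangle\in s+2\mathbb Z$. -/

import Mathlib

open Complex Filter Topology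

noncomputable section

namespace SklyaninKernel

/-! The two periods are packed in `a : Bool → ℂ`, with `a true = a₊` and `a false = a₋`.
For a sign `δ : Bool` the opposite sign is `!δ`. -/

/-- `q = exp (-π a)`. -/
def nome (a : ℂ) : ℂ := exp (-(Real.pi : ℂ) * a)

/-- `R(z) = ∏_{k ≥ 1} (1 - q^(2k-1) e^(2πiz)) (1 - q^(2k-1) e^(-2πiz))`, where `q = exp (-π a)`. -/
def R (a z : ℂ) : ℂ :=
  ∏' k : ℕ, ((1 - nome a ^ (2 * k + 1) * exp (2 * Real.pi * I * z)) *
    (1 - nome a ^ (2 * k + 1) * exp (-(2 * Real.pi * I * z))))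

/-- The factor `1 - q₊^(2m-1) q₋^(2n-1) e^(2πiz)`, with `m - 1, n - 1` the two entries of `p`. -/
def gammaFactor (a : Bool → ℂ) (p : ℕ × ℕ) (z : ℂ) : ℂ :=
  1 - nome (a true) ^ (2 * p.1 + 1) * nome (a false) ^ (2 * p.2 + 1) * exp (2 * Real.pi * I * z)

/-- The elliptic gamma function with real period `1`:
`G(z) = ∏_{m,n ≥ 1} (1 - q₊^(2m-1) q₋^(2n-1) e^(-2πiz)) / (1 - q₊^(2m-1) q₋^(2n-1) e^(2πiz))`. -/
def G (a : Bool → ℂ) (z : ℂ) : ℂ :=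
  (∏' p : ℕ × ℕ, gammaFactor a p (-z)) / ∏' p : ℕ × ℕ, gammaFactor a p z

/-- `z` is not a pole of `G`. -/
def GRegular (a : Bool → ℂ) (z : ℂ) : Prop := ∀ p : ℕ × ℕ, gammaFactor a p z ≠ 0

/-- `K(γ; z, y) = G(z+y-γ) G(z-y-γ) G(-z+y-γ) G(-z-y-γ)`. -/
def K (a : Bool → ℂ) (γ z y : ℂ) : ℂ :=
  G a (z + y - γ) * G a (z - y - γ) * G a (-z + y - γ) * G a (-z - y - γ)

/-- No factor of `K(γ; z, y)` is at a pole. -/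
def KRegular (a : Bool → ℂ) (γ z y : ℂ) : Prop :=
  GRegular a (z + y - γ) ∧ GRegular a (z - y - γ) ∧
    GRegular a (-z + y - γ) ∧ GRegular a (-z - y - γ)

/-- `f_δ(l; z) = ∏_{n=1}^4 R_δ(z + l_n + i a_{-δ}/4) / R_δ(2z - i a_δ/2)`. -/
def coeff (a : Bool → ℂ) (δ : Bool) (l : Fin 4 → ℂ) (z : ℂ) : ℂ :=
  (∏ n, R (a δ) (z + l n + I * a (!δ) / 4)) / R (a δ) (2 * z - I * a δ / 2)

/-- The denominators of `f_δ(l; z)` and `f_δ(l; -z)` do not vanish. -/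
def CoeffRegular (a : Bool → ℂ) (δ : Bool) (z : ℂ) : Prop :=
  R (a δ) (2 * z - I * a δ / 2) ≠ 0 ∧ R (a δ) (2 * (-z) - I * a δ / 2) ≠ 0

/-- The shift `i a_{-δ}/2`. -/
def step (a : Bool → ℂ) (δ : Bool) : ℂ := I * a (!δ) / 2

/-- The action of `A_{R,δ}(l; z) = f_δ(l; z) exp(i a_{-δ} ∂_z / 2) + (z → -z)` on functions. -/
def act (a : Bool → ℂ) (δ : Bool) (l : Fin 4 → ℂ) (F : ℂ → ℂ) (z : ℂ) : ℂ :=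
  coeff a δ l z * F (z + step a δ) + coeff a δ l (-z) * F (z - step a δ)

/-- `φ₁(l) = -l + ⟨κ, l⟩ κ / 2`, with `κ = (1,1,1,1)`. -/
def phi1 (l : Fin 4 → ℂ) : Fin 4 → ℂ := fun n => -l n + (∑ m, l m) / 2

/-- `φ₂(l) = φ₁(l) + κ / 2`. -/
def phi2 (l : Fin 4 → ℂ) : Fin 4 → ℂ := fun n => phi1 l n + 1 / 2

/-- The identity `A_{R,δ}(l; z) K(γ; z, y) = A_{R,δ}(l'; y) K(γ; z, y)` of meromorphic functions
of `(z, y)`: both sides agree at every point where all the functions involved are regular. -/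
def KernelIdentity (a : Bool → ℂ) (δ : Bool) (l l' : Fin 4 → ℂ) (γ : ℂ) : Prop :=
  ∀ z y : ℂ, CoeffRegular a δ z → CoeffRegular a δ y →
    KRegular a γ (z + step a δ) y → KRegular a γ (z - step a δ) y →
    KRegular a γ z (y + step a δ) → KRegular a γ z (y - step a δ) →
    act a δ l (fun z' => K a γ z' y) z = act a δ l' (fun y' => K a γ z y') y

/-! ### The space of even meromorphic functions and the operators on it -/

theorem norm_nome_lt_one {a : ℂ} (ha : 0 < a.re) : ‖nome a‖ < 1 := by
  rw [nome, Complex.norm_exp]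
  simp [Real.pi_pos, ha]

theorem differentiable_R {a : ℂ} (ha : 0 < a.re) : Differentiable ℂ (R a) := by
  have hq := norm_nome_lt_one ha
  intro z₀
  set r : ℝ := ‖z₀‖ + 1 with hr
  have hz₀ : z₀ ∈ Metric.ball (0 : ℂ) r := by simp [hr]
  set B : ℝ := Real.exp (2 * Real.pi * r) with hB
  have hexp : ∀ z ∈ Metric.ball (0 : ℂ) r,
      ‖exp (2 * Real.pi * I * z)‖ ≤ B ∧ ‖exp (-(2 * Real.pi * I * z))‖ ≤ B := by
    intro z hz
    have hz' : ‖z‖ ≤ r := by simpa using (Metric.mem_ball.1 hz).le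
    have h : ‖2 * (Real.pi : ℂ) * I * z‖ ≤ 2 * Real.pi * r := by
      simp only [norm_mul, Complex.norm_ofNat, Complex.norm_real, Complex.norm_I, mul_one,
        Real.norm_eq_abs, abs_of_pos Real.pi_pos]
      gcongr
    constructor
    · exact (Complex.norm_exp_le_exp_norm _).trans (Real.exp_le_exp.2 h)
    · exact (Complex.norm_exp_le_exp_norm _).trans (Real.exp_le_exp.2 (by rwa [norm_neg]))
  have hs : Summable fun k : ℕ => ‖nome a‖ ^ k * (2 * B + 1) :=
    (summable_geometric_of_lt_one (norm_nonneg _) hq).mul_right _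
  have key := Summable.hasProdLocallyUniformlyOn_one_add
    (f := fun (k : ℕ) (z : ℂ) =>
      (1 - nome a ^ (2 * k + 1) * exp (2 * Real.pi * I * z)) *
        (1 - nome a ^ (2 * k + 1) * exp (-(2 * Real.pi * I * z))) - 1)
    (Metric.isOpen_ball (x := (0 : ℂ)) (ε := r)) hs
    (.of_forall fun k z hz => by
      obtain ⟨h1, h2⟩ := hexp z hz
      have hc : ‖nome a ^ (2 * k + 1)‖ ≤ ‖nome a‖ ^ k := by
        rw [norm_pow]
        exact pow_le_pow_of_le_one (norm_nonneg _) hq.le (by omega)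
      have hc1 : ‖nome a ^ (2 * k + 1)‖ ≤ 1 := by
        rw [norm_pow]
        exact pow_le_one₀ (norm_nonneg _) hq.le
      have hu : exp (2 * Real.pi * I * z) * exp (-(2 * Real.pi * I * z)) = 1 := by
        rw [← Complex.exp_add]; simp
      generalize nome a ^ (2 * k + 1) = c at *
      generalize exp (2 * Real.pi * I * z) = u at *
      generalize exp (-(2 * Real.pi * I * z)) = v at *
      have : (1 - c * u) * (1 - c * v) - 1 = c * (c - u - v) := by
        linear_combination c ^ 2 * hu
      rw [this, norm_mul]
      have h3 : ‖c - u - v‖ ≤ 2 * B + 1 := by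
        calc ‖c - u - v‖ ≤ ‖c‖ + ‖u‖ + ‖v‖ :=
              (norm_sub_le _ _).trans (by gcongr; exact norm_sub_le _ _)
          _ ≤ 2 * B + 1 := by linarith
      gcongr)
    (fun k => by fun_prop)
  have hd : DifferentiableOn ℂ (R a) (Metric.ball 0 r) := by
    have := key.differentiableOn (.of_forall fun s => by
      simpa [Finset.prod_fn] using DifferentiableOn.finsetProd (fun _ _ ↦ by fun_prop))
      Metric.isOpen_ball
    have h : R a = fun x => ∏' k : ℕ, (1 + ((1 - nome a ^ (2 * k + 1) *
        exp (2 * Real.pi * I * x)) * (1 - nome a ^ (2 * k + 1) *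
          exp (-(2 * Real.pi * I * x))) - 1)) := by
      funext x
      simp [R]
    rw [h]
    exact this
  exact hd.differentiableAt (Metric.isOpen_ball.mem_nhds hz₀)

theorem meromorphic_coeff {a : Bool → ℂ} (ha : ∀ δ, 0 < (a δ).re) (δ : Bool) (l : Fin 4 → ℂ) :
    Meromorphic (coeff a δ l) := by
  have hR : ∀ g : ℂ → ℂ, Differentiable ℂ g → Meromorphic fun z => R (a δ) (g z) := fun g hg x =>
    (((differentiable_R (ha δ)).comp hg).analyticAt x).meromorphicAt
  unfold coeff
  exact (Meromorphic.fun_prod fun n _ => hR _ (by fun_prop)).fun_div (hR _ (by fun_prop))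

theorem meromorphic_comp {f g : ℂ → ℂ} (hf : Meromorphic f) (c d : ℂ)
    (hg : g = fun z => f (c * z + d)) : Meromorphic g := by
  subst hg
  exact fun x => (hf (c * x + d)).comp_analyticAt (g := fun z => c * z + d) (by fun_prop)

/-- Even meromorphic functions on `ℂ`, with (irrelevant) values at the poles. -/
def evenFunctions : Submodule ℂ (ℂ → ℂ) where
  carrier := {f | Meromorphic f ∧ ∀ z, f (-z) = f z}
  add_mem' hf hg := ⟨hf.1.add hg.1, fun z => by simp [hf.2 z, hg.2 z]⟩
  zero_mem' := ⟨Meromorphic.const 0, fun _ => rfl⟩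
  smul_mem' c _ hf := ⟨hf.1.const_smul c, fun z => by simp [hf.2 z]⟩

/-- Functions that vanish off a discrete closed set. -/
def negligible : Submodule ℂ evenFunctions where
  carrier := {f | ∀ z : ℂ, ∀ᶠ w in 𝓝[≠] z, (f : ℂ → ℂ) w = 0}
  add_mem' hf hg z := by
    filter_upwards [hf z, hg z] with w h1 h2
    simp [h1, h2]
  zero_mem' z := by simp
  smul_mem' c f hf z := by
    filter_upwards [hf z] with w h
    simp [h]

/-- The space `𝓜ₑ` of even meromorphic functions on `ℂ`: two functions are identified when they
agree off a discrete closed set. -/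
abbrev Me : Type := evenFunctions ⧸ negligible

theorem act_mem {a : Bool → ℂ} (ha : ∀ δ, 0 < (a δ).re) (δ : Bool) (l : Fin 4 → ℂ)
    {F : ℂ → ℂ} (hF : F ∈ evenFunctions) : act a δ l F ∈ evenFunctions := by
  refine ⟨?_, fun z => ?_⟩
  · have h1 := meromorphic_coeff ha δ l
    have h2 : Meromorphic fun z => coeff a δ l (-z) :=
      meromorphic_comp h1 (-1) 0 (by simp)
    have h3 : Meromorphic fun z => F (z + step a δ) :=
      meromorphic_comp hF.1 1 (step a δ) (by simp)
    have h4 : Meromorphic fun z => F (z - step a δ) :=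
      meromorphic_comp hF.1 1 (-step a δ) (by simp [sub_eq_add_neg])
    exact (h1.fun_mul h3).fun_add (h2.fun_mul h4)
  · have h1 : F (-z + step a δ) = F (z - step a δ) := by
      rw [← hF.2 (z - step a δ)]; congr 1; ring
    have h2 : F (-z - step a δ) = F (z + step a δ) := by
      rw [← hF.2 (z + step a δ)]; congr 1; ring
    simp only [act, h1, h2, neg_neg]
    ring

/-- `A_{R,δ}(l; z)` on even meromorphic functions with values at the poles. -/
def actLinear (a : Bool → ℂ) (ha : ∀ δ, 0 < (a δ).re) (δ : Bool) (l : Fin 4 → ℂ) :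
    evenFunctions →ₗ[ℂ] evenFunctions where
  toFun F := ⟨act a δ l F, act_mem ha δ l F.2⟩
  map_add' F F' := by
    ext z
    simp only [act, Submodule.coe_add, Pi.add_apply]
    ring
  map_smul' c F := by
    ext z
    simp only [act, Submodule.coe_smul, Pi.smul_apply, smul_eq_mul, RingHom.id_apply]
    ring

theorem actLinear_negligible (a : Bool → ℂ) (ha : ∀ δ, 0 < (a δ).re) (δ : Bool)
    (l : Fin 4 → ℂ) : negligible ≤ negligible.comap (actLinear a ha δ l) := by
  intro F hF z
  have hshift : ∀ c : ℂ, ∀ᶠ w in 𝓝[≠] z, (F : ℂ → ℂ) (w + c) = 0 := fun c => by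
    have ht : Tendsto (fun w : ℂ => w + c) (𝓝[≠] z) (𝓝[≠] (z + c)) :=
      tendsto_nhdsWithin_of_tendsto_nhds_of_eventually_within _
        (((continuous_id.add continuous_const).tendsto z).mono_left nhdsWithin_le_nhds)
        (by filter_upwards [self_mem_nhdsWithin] with w hw; simpa using hw)
    exact ht.eventually (hF (z + c))
  filter_upwards [hshift (step a δ), hshift (-step a δ)] with w h1 h2
  rw [← sub_eq_add_neg] at h2
  simp [actLinear, act, h1, h2]

/-- The operator `A_{R,δ}(l; z)` as an endomorphism of `𝓜ₑ`. -/
def generator (a : Bool → ℂ) (ha : ∀ δ, 0 < (a δ).re) (δ : Bool) (l : Fin 4 → ℂ) :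
    Module.End ℂ Me :=
  negligible.mapQ negligible (actLinear a ha δ l) (actLinear_negligible a ha δ l)

/-- The multiplier `μ = exp(-2πi (s + 2ia))`, where `s = ∑ l_n` and `2a = a₊ + a₋`. -/
def multiplier (a : Bool → ℂ) (s : ℂ) : ℂ :=
  exp (-(2 * Real.pi * I) * (s + I * (a true + a false)))

/-- The representation `𝒟(μ)` of the Sklyanin algebra `𝒮_δ`, as an algebra of operators on `𝓜ₑ`:
it is generated by the operators `A_{R,δ}(l; z)` with multiplier `μ`. -/
def representation (a : Bool → ℂ) (ha : ∀ δ, 0 < (a δ).re) (δ : Bool) (μ : ℂ) :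
    Subalgebra ℂ (Module.End ℂ Me) :=
  Algebra.adjoin ℂ {A | ∃ l : Fin 4 → ℂ, multiplier a (∑ n, l n) = μ ∧ generator a ha δ l = A}

/-- `A_{R,δ}(l; z) ↦ A_{R,δ}(φ(l); z)`, for all `l` whose entries sum to `s` modulo `2`, extends to
an order-reversing involutive automorphism of the representation `𝒟(μ)` of `𝒮_δ`, where `μ` is the
multiplier of these operators. -/
def ExtendsToReversal (a : Bool → ℂ) (ha : ∀ δ, 0 < (a δ).re) (δ : Bool) (s : ℂ)
    (φ : (Fin 4 → ℂ) → (Fin 4 → ℂ)) : Prop :=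
  ∃ Φ : representation a ha δ (multiplier a s) ≃ₗ[ℂ] representation a ha δ (multiplier a s),
    Φ 1 = 1 ∧ (∀ X Y, Φ (X * Y) = Φ Y * Φ X) ∧ (∀ X, Φ (Φ X) = X) ∧
    ∀ l : Fin 4 → ℂ, (∃ m : ℤ, ∑ n, l n = s + 2 * m) →
      ∀ X : representation a ha δ (multiplier a s),
        (X : Module.End ℂ Me) = generator a ha δ l →
          (Φ X : Module.End ℂ Me) = generator a ha δ (φ l)

end SklyaninKernel

end

noncomputable section

namespace SklyaninKernel

/-! Kernel identities. With s = i a_{-δ}/2, the difference equation G(u + s) = R_δ(u) G(u - s)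
(`G_add_step`) lets a common product of four values of G be factored out of both sides. What remains
is a four-term identity between products of R_δ (`coeff_four_term`). Written with the odd theta
function, the four factors R_δ(z + l_n + ...) pair into two brackets θ(x + y)θ(x - y), and the
identity becomes a linear combination of Weierstrass addition formulas (`bracket_plucker`), which
follow from Liouville's theorem.

Reversals. It suffices that every noncommutative polynomial relation p among the A(l) gives the
reversed relation p* among the A(φ(l)) (`exists_reversal`). Suppose A(l; z) k = A(φ(l); y) k for all
l in play. Operators in z commute with operators in y, so p(A(l; z)) k = p*(A(φ(l); y)) k
(`lift_apply_eq_lift_star_apply`). If p is a relation, the left side is 0, and p* is a relation as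
soon as the kernels k separate enough functionals. The condition on γ sees ∑ l_n only modulo 2, so
one γ serves all generators.

Nondegeneracy is checked on grids z₀ + ℤs, where the operators are infinite band matrices. Relations
on meromorphic functions correspond to relations on generic grids (`lift_gridOp_eq_zero`,
`lift_generator_eq_zero`). A grid kernel D((i - j)/2) H((i + j)/2) is built from the first-order
recursions that K satisfies in z - y and z + y. For nonresonant γ a limit in z₀ isolates a single
evaluation (`reverses_of_nonresonant`). For resonant γ the parameter i(a₊ + a₋) - γ, which belongs
to -l, admits a D of finite support and hence a triangular kernel (`reverses_of_finite_kernel`).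
Transposition, a diagonal kernel relating l to -l (`reverses_neg`), applied on both sides leads back
to l: three reversals make one. -/

/-! ### Infinite q-Pochhammer products: zeros and their simplicity. -/

/-- The infinite `q`-Pochhammer symbol `∏_{k ≥ 0} (1 - p^k x)`. -/
def poch (p x : ℂ) : ℂ := ∏' k : ℕ, (1 - p ^ k * x)

theorem multipliable_poch {p : ℂ} (hp : ‖p‖ < 1) (x : ℂ) :
    Multipliable fun k : ℕ => 1 - p ^ k * x := by
  have : Summable fun k : ℕ => ‖-(p ^ k * x)‖ := by
    simpa using (summable_geometric_of_lt_one (norm_nonneg p) hp).mul_right ‖x‖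
  simpa [sub_eq_add_neg] using multipliable_one_add_of_summable this

theorem poch_eq {p : ℂ} (hp : ‖p‖ < 1) (x : ℂ) : poch p x = (1 - x) * poch p (p * x) := by
  have h := tprod_eq_zero_mul' (f := fun k : ℕ => 1 - p ^ k * x)
    (by simpa [pow_succ, mul_assoc] using multipliable_poch hp (p * x))
  simpa [poch, pow_succ, mul_assoc] using h

theorem poch_ne_zero {p : ℂ} (hp : ‖p‖ < 1) {x : ℂ} (hx : ∀ k : ℕ, p ^ k * x ≠ 1) :
    poch p x ≠ 0 := by
  have hs : Summable fun k : ℕ => ‖-(p ^ k * x)‖ := by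
    simpa using (summable_geometric_of_lt_one (norm_nonneg p) hp).mul_right ‖x‖
  have := tprod_one_add_ne_zero_of_summable (f := fun k : ℕ => -(p ^ k * x))
    (fun k h => hx k (by linear_combination -h)) hs
  simpa [poch, sub_eq_add_neg] using this

theorem poch_eq_zero_of {p : ℂ} (hp : ‖p‖ < 1) (k : ℕ) : ∀ {x : ℂ}, p ^ k * x = 1 →
    poch p x = 0 := by
  induction k with
  | zero => intro x hx; rw [poch_eq hp]; simp at hx; simp [hx]
  | succ k ih =>
    intro x hx
    rw [poch_eq hp, ih (by rw [← hx]; ring), mul_zero]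

theorem differentiable_poch {p : ℂ} (hp : ‖p‖ < 1) : Differentiable ℂ (poch p) := by
  intro x₀
  set r : ℝ := ‖x₀‖ + 1 with hr
  have hx₀ : x₀ ∈ Metric.ball (0 : ℂ) r := by simp [hr]
  have hs : Summable fun k : ℕ => ‖p‖ ^ k * r :=
    (summable_geometric_of_lt_one (norm_nonneg _) hp).mul_right _
  have key := Summable.hasProdLocallyUniformlyOn_one_add
    (f := fun (k : ℕ) (x : ℂ) => -(p ^ k * x))
    (Metric.isOpen_ball (x := (0 : ℂ)) (ε := r)) hs
    (.of_forall fun k x hx => by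
      have : ‖x‖ ≤ r := by simpa using (Metric.mem_ball.1 hx).le
      simp only [norm_neg, norm_mul, norm_pow]
      gcongr)
    (fun k => by fun_prop)
  have hd := key.differentiableOn (.of_forall fun s => by
      simpa [Finset.prod_fn] using DifferentiableOn.finsetProd (fun _ _ ↦ by fun_prop))
      Metric.isOpen_ball
  have h : poch p = fun x => ∏' k : ℕ, (1 + -(p ^ k * x)) := by
    funext x
    simp [poch, sub_eq_add_neg]
  rw [h]
  exact hd.differentiableAt (Metric.isOpen_ball.mem_nhds hx₀)

/-- Differentiate the functional equation `poch_eq`. At x = 1 only the term -poch(p) survives; any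
other zero is carried to x = 1 by repeated multiplication by p. -/
theorem deriv_poch_ne_zero {p : ℂ} (hp : ‖p‖ < 1) (hp0 : p ≠ 0) (k : ℕ) :
    ∀ {x : ℂ}, p ^ k * x = 1 → deriv (poch p) x ≠ 0 := by
  have hd := differentiable_poch hp
  have hder : ∀ x, deriv (poch p) x = -poch p (p * x) + (1 - x) * (deriv (poch p) (p * x) * p) := by
    intro x
    have h1 : HasDerivAt (fun x : ℂ => 1 - x) (-1) x := by
      simpa using (hasDerivAt_id x).const_sub 1
    have h2 : HasDerivAt (fun x : ℂ => poch p (p * x)) (deriv (poch p) (p * x) * p) x := by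
      have := (hd (p * x)).hasDerivAt.comp x ((hasDerivAt_id x).const_mul p)
      simpa [Function.comp_def] using this
    have h3 := h1.mul h2
    have h4 : poch p = fun x => (1 - x) * poch p (p * x) := funext fun x => poch_eq hp x
    conv_lhs => rw [h4]
    have := h3.deriv
    simp only [Pi.mul_def] at this
    rw [this]; ring
  induction k with
  | zero =>
    intro x hx
    have hx : x = 1 := by simpa using hx
    subst hx
    rw [hder]
    simp only [sub_self, zero_mul, add_zero, ne_eq, neg_eq_zero]
    refine poch_ne_zero hp fun k hk => ?_
    have : ‖p ^ (k + 1)‖ < 1 := by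
      rw [norm_pow]; exact pow_lt_one₀ (norm_nonneg _) hp (by omega)
    rw [pow_succ, show p ^ k * p = 1 by simpa using hk] at this
    simp at this
  | succ k ih =>
    intro x hx
    have h1 : p ^ k * (p * x) = 1 := by rw [← hx]; ring
    rw [hder, poch_eq_zero_of hp k h1]
    have hx1 : 1 - x ≠ 0 := by
      intro h
      have hx' : x = 1 := by linear_combination -h
      have : ‖p ^ (k + 1)‖ < 1 := by
        rw [norm_pow]; exact pow_lt_one₀ (norm_nonneg _) hp (by omega)
      rw [show p ^ (k + 1) = 1 by simpa [hx'] using hx] at this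
      simp at this
    simpa using ⟨hx1, ih h1, hp0⟩

/-! ### The theta function `R` -/

theorem nome_ne_zero (a : ℂ) : nome a ≠ 0 := exp_ne_zero _

theorem norm_nome_sq_lt_one {a : ℂ} (ha : 0 < a.re) : ‖nome a ^ 2‖ < 1 := by
  rw [norm_pow]; exact pow_lt_one₀ (norm_nonneg _) (norm_nome_lt_one ha) (by omega)

theorem R_eq_poch {a : ℂ} (ha : 0 < a.re) (z : ℂ) :
    R a z = poch (nome a ^ 2) (nome a * exp (2 * Real.pi * I * z)) *
      poch (nome a ^ 2) (nome a * exp (-(2 * Real.pi * I * z))) := by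
  have hp := norm_nome_sq_lt_one ha
  rw [poch, poch, ← (multipliable_poch hp _).tprod_mul (multipliable_poch hp _), R]
  refine tprod_congr fun k => ?_
  ring

theorem R_neg (a z : ℂ) : R a (-z) = R a z := by
  unfold R
  refine tprod_congr fun k => ?_
  rw [mul_comm]; simp

theorem R_add_one (a z : ℂ) : R a (z + 1) = R a z := by
  unfold R
  have h1 : exp (2 * Real.pi * I * (z + 1)) = exp (2 * Real.pi * I * z) := by
    rw [mul_add, mul_one, exp_periodic]
  have h2 : exp (-(2 * Real.pi * I * (z + 1))) = exp (-(2 * Real.pi * I * z)) := by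
    rw [exp_neg, exp_neg, h1]
  simp only [h1, h2]

theorem R_add_int (a z : ℂ) (m : ℤ) : R a (z + m) = R a z := by
  have h : Function.Periodic (R a) 1 := R_add_one a
  simpa using h.int_mul m z

/-- Recentring at a zero splits off one vanishing factor and leaves a cofactor that is even in z;
the quasiperiodicity in `R_add_half` comes from this. -/
theorem R_sub_half {a : ℂ} (ha : 0 < a.re) (z : ℂ) :
    R a (z - I * a / 2) = (1 - exp (2 * Real.pi * I * z)) *
      (poch (nome a ^ 2) (nome a ^ 2 * exp (2 * Real.pi * I * z)) *
        poch (nome a ^ 2) (nome a ^ 2 * exp (-(2 * Real.pi * I * z)))) := by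
  have hp := norm_nome_sq_lt_one ha
  have h1 : nome a * exp (2 * Real.pi * I * (z - I * a / 2)) = exp (2 * Real.pi * I * z) := by
    rw [nome, ← exp_add]; congr 1; linear_combination (-Real.pi * a : ℂ) * I_sq
  have h2 : nome a * exp (-(2 * Real.pi * I * (z - I * a / 2))) =
      nome a ^ 2 * exp (-(2 * Real.pi * I * z)) := by
    rw [nome, ← exp_nat_mul, ← exp_add, ← exp_add]; congr 1
    push_cast; linear_combination (Real.pi * a : ℂ) * I_sq
  rw [R_eq_poch ha, h1, h2, poch_eq hp (exp _)]
  ring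

/-- `R` changes sign up to an exponential under half a quasiperiod. -/
theorem R_add_half {a : ℂ} (ha : 0 < a.re) (z : ℂ) :
    R a (z + I * a / 2) = -exp (-(2 * Real.pi * I * z)) * R a (z - I * a / 2) := by
  have h := R_sub_half ha (-z)
  rw [show -z - I * a / 2 = -(z + I * a / 2) by ring, R_neg] at h
  rw [h, R_sub_half ha]
  have hu : exp (2 * Real.pi * I * z) * exp (-(2 * Real.pi * I * z)) = 1 := by
    rw [← exp_add]; simp
  simp only [mul_neg, neg_neg]
  linear_combination (-(poch (nome a ^ 2) (nome a ^ 2 * exp (2 * Real.pi * I * z)) *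
        poch (nome a ^ 2) (nome a ^ 2 * exp (-(2 * Real.pi * I * z))))) * hu

theorem R_half {a : ℂ} (ha : 0 < a.re) : R a (I * a / 2) = 0 := by
  rw [← R_neg, show -(I * a / 2) = 0 - I * a / 2 by ring, R_sub_half ha]
  simp

/-- The multiplier of `R` under the shift by `n` quasiperiods. -/
def mult (a : ℂ) (n : ℤ) (z : ℂ) : ℂ :=
  exp (Real.pi * I * n - 2 * Real.pi * I * n * z + Real.pi * a * n ^ 2)

theorem mult_ne_zero (a : ℂ) (n : ℤ) (z : ℂ) : mult a n z ≠ 0 := exp_ne_zero _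

theorem R_add_period {a : ℂ} (ha : 0 < a.re) (z : ℂ) :
    R a (z + I * a) = mult a 1 z * R a z := by
  have h := R_add_half ha (z + I * a / 2)
  rw [show z + I * a / 2 + I * a / 2 = z + I * a by ring,
    show z + I * a / 2 - I * a / 2 = z by ring] at h
  rw [h, mult]
  congr 1
  rw [show (Real.pi * I * (1 : ℤ) - 2 * Real.pi * I * (1 : ℤ) * z + Real.pi * a * (1 : ℤ) ^ 2 : ℂ)
    = Real.pi * I + -(2 * Real.pi * I * (z + I * a / 2)) by
      push_cast; linear_combination (-(Real.pi * a : ℂ)) * (-I_sq), exp_add, exp_pi_mul_I]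
  ring

theorem R_add_int_period {a : ℂ} (ha : 0 < a.re) (n : ℤ) :
    ∀ z, R a (z + n * (I * a)) = mult a n z * R a z := by
  have hstep : ∀ (n : ℤ) (z : ℂ), mult a 1 (z + n * (I * a)) * mult a n z = mult a (n + 1) z := by
    intro n z
    rw [mult, mult, mult, ← exp_add]
    congr 1
    push_cast
    linear_combination (-(2 * Real.pi * n * a : ℂ)) * I_sq
  induction n using Int.induction_on with
  | zero => intro z; simp [mult]
  | succ i ih =>
    intro z
    rw [show z + ((i + 1 : ℤ) : ℂ) * (I * a) = z + (i : ℤ) * (I * a) + I * a by push_cast; ring,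
      R_add_period ha, ih, ← hstep]
    ring
  | pred i ih =>
    intro z
    have h1 := R_add_period ha (z + (-i - 1 : ℤ) * (I * a))
    rw [show z + ((-i - 1 : ℤ) : ℂ) * (I * a) + I * a = z + (-i : ℤ) * (I * a) by push_cast; ring,
      ih] at h1
    have h2 := hstep (-i - 1) z
    rw [show (-(i : ℤ) - 1 + 1) = -i by ring] at h2
    rw [← h2] at h1
    have h3 := mult_ne_zero a 1 (z + (-i - 1 : ℤ) * (I * a))
    have h4 : mult a 1 (z + (-i - 1 : ℤ) * (I * a)) *
      (R a (z + (-i - 1 : ℤ) * (I * a)) - mult a (-i - 1) z * R a z) = 0 := by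
      linear_combination -h1
    rcases mul_eq_zero.1 h4 with h | h
    · exact absurd h h3
    · exact sub_eq_zero.1 h

theorem R_add_lattice {a : ℂ} (ha : 0 < a.re) (m n : ℤ) (z : ℂ) :
    R a (z + (m + n * (I * a))) = mult a n z * R a z := by
  rw [← R_add_int_period ha, show z + (m + n * (I * a)) = z + n * (I * a) + m by ring, R_add_int]

theorem exists_of_nome_pow {a : ℂ} {k : ℕ} {z : ℂ}
    (h : (nome a ^ 2) ^ k * (nome a * exp (2 * Real.pi * I * z)) = 1) :
    ∃ m n : ℤ, z = I * a / 2 + (m + n * (I * a)) := by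
  rw [nome, ← exp_nat_mul, ← exp_nat_mul, ← exp_add, ← exp_add, exp_eq_one_iff] at h
  obtain ⟨n, hn⟩ := h
  have hpi : (2 * Real.pi * I : ℂ) ≠ 0 := two_pi_I_ne_zero
  refine ⟨n, -k - 1, ?_⟩
  apply mul_left_cancel₀ hpi
  push_cast at hn ⊢
  linear_combination hn + (2 * Real.pi * k * a + Real.pi * a : ℂ) * I_sq

theorem exists_of_R_eq_zero {a : ℂ} (ha : 0 < a.re) {z : ℂ} (h : R a z = 0) :
    ∃ m n : ℤ, z = I * a / 2 + (m + n * (I * a)) := by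
  have hp := norm_nome_sq_lt_one ha
  rw [R_eq_poch ha, mul_eq_zero] at h
  rcases h with h | h
  · obtain ⟨k, hk⟩ : ∃ k : ℕ, _ := by
      by_contra hc
      exact poch_ne_zero hp (not_exists.1 hc) h
    exact exists_of_nome_pow hk
  · obtain ⟨k, hk⟩ : ∃ k : ℕ, _ := by
      by_contra hc
      exact poch_ne_zero hp (not_exists.1 hc) h
    rw [← mul_neg] at hk
    obtain ⟨m, n, hm⟩ := exists_of_nome_pow hk
    refine ⟨-m, -n - 1, ?_⟩
    push_cast
    linear_combination -hm

theorem deriv_R_ne_zero {a : ℂ} (ha : 0 < a.re) {z : ℂ} (h : R a z = 0) :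
    deriv (R a) z ≠ 0 := by
  have hp := norm_nome_sq_lt_one ha
  have hp0 : nome a ^ 2 ≠ 0 := pow_ne_zero _ (nome_ne_zero a)
  have aux : ∀ {z : ℂ}, poch (nome a ^ 2) (nome a * exp (2 * Real.pi * I * z)) = 0 →
      deriv (R a) z ≠ 0 := by
    intro z hz
    obtain ⟨k, hk⟩ : ∃ k : ℕ, (nome a ^ 2) ^ k * (nome a * exp (2 * Real.pi * I * z)) = 1 := by
      by_contra hc
      exact poch_ne_zero hp (not_exists.1 hc) hz
    -- The two Pochhammer factors of R cannot vanish together: multiplying the two vanishing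
    -- conditions would make a positive power of the nome equal to 1.
    have hne : poch (nome a ^ 2) (nome a * exp (-(2 * Real.pi * I * z))) ≠ 0 := by
      refine poch_ne_zero hp fun j hj => ?_
      have h1 : nome a ^ (2 * k + 2 * j + 2) = 1 := by
        have hu : exp (2 * Real.pi * I * z) * exp (-(2 * Real.pi * I * z)) = 1 := by
          rw [← exp_add]; simp
        calc nome a ^ (2 * k + 2 * j + 2)
            = nome a ^ (2 * k + 2 * j + 2) *
              (exp (2 * Real.pi * I * z) * exp (-(2 * Real.pi * I * z))) := by rw [hu, mul_one]
          _ = ((nome a ^ 2) ^ k * (nome a * exp (2 * Real.pi * I * z))) *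
              ((nome a ^ 2) ^ j * (nome a * exp (-(2 * Real.pi * I * z)))) := by ring
          _ = 1 := by rw [hk, hj, mul_one]
      have : ‖nome a ^ (2 * k + 2 * j + 2)‖ < 1 := by
        rw [norm_pow]; exact pow_lt_one₀ (norm_nonneg _) (norm_nome_lt_one ha) (by omega)
      rw [h1] at this
      simp at this
    have he : HasDerivAt (fun z : ℂ => nome a * exp (2 * Real.pi * I * z))
        (nome a * (exp (2 * Real.pi * I * z) * (2 * Real.pi * I))) z := by
      have := (((hasDerivAt_id z).const_mul (2 * Real.pi * I : ℂ)).cexp).const_mul (nome a)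
      simpa using this
    have he' : HasDerivAt (fun z : ℂ => nome a * exp (-(2 * Real.pi * I * z)))
        (nome a * (exp (-(2 * Real.pi * I * z)) * (-(2 * Real.pi * I)))) z := by
      have := ((((hasDerivAt_id z).const_mul (2 * Real.pi * I : ℂ)).neg).cexp).const_mul (nome a)
      simpa using this
    have h1 := (differentiable_poch hp _).hasDerivAt.comp z he
    have h2 := (differentiable_poch hp _).hasDerivAt.comp z he'
    have h3 := (h1.mul h2).deriv
    have h4 : R a = (poch (nome a ^ 2) ∘ fun z : ℂ => nome a * exp (2 * Real.pi * I * z)) *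
        (poch (nome a ^ 2) ∘ fun z : ℂ => nome a * exp (-(2 * Real.pi * I * z))) :=
      funext fun z => R_eq_poch ha z
    rw [h4, h3]
    simp only [Function.comp_apply, hz, zero_mul, add_zero]
    exact mul_ne_zero (mul_ne_zero (deriv_poch_ne_zero hp hp0 k hk)
      (mul_ne_zero (nome_ne_zero a) (mul_ne_zero (exp_ne_zero _) two_pi_I_ne_zero))) hne
  rw [R_eq_poch ha, mul_eq_zero] at h
  rcases h with h | h
  · exact aux h
  · rw [← mul_neg] at h
    have h1 := aux h
    intro h2
    apply h1
    have h3 : R a = fun x => R a (-x) := funext fun x => (R_neg a x).symm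
    rw [h3, deriv_comp_neg, neg_neg, h2, neg_zero]

/-! ### Countable exceptional sets, division of entire functions, Liouville's theorem. -/

theorem countable_R_zeros {a : ℂ} (ha : 0 < a.re) : {z | R a z = 0}.Countable := by
  refine (Set.countable_range fun p : ℤ × ℤ => I * a / 2 + (p.1 + p.2 * (I * a))).mono ?_
  intro z hz
  obtain ⟨m, n, h⟩ := exists_of_R_eq_zero ha hz
  exact ⟨(m, n), h.symm⟩

theorem dense_compl_of_countable {s : Set ℂ} (hs : s.Countable) : Dense sᶜ :=
  hs.dense_compl ℝ

theorem eq_zero_of_countable {f : ℂ → ℂ} (hf : Continuous f) {s : Set ℂ} (hs : s.Countable)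
    (h : ∀ x, x ∉ s → f x = 0) (x : ℂ) : f x = 0 := by
  have := Continuous.ext_on (dense_compl_of_countable hs) hf continuous_const
    (fun x hx => (h x hx : f x = 0))
  exact congrFun this x

theorem countable_zeros_comp_mul_add {f : ℂ → ℂ} (hf : {z | f z = 0}.Countable) {c : ℂ}
    (hc : c ≠ 0) (d : ℂ) : {z | f (c * z + d) = 0}.Countable :=
  hf.preimage_of_injOn (f := fun z => c * z + d) fun x _ y _ h => by
    simpa [hc] using h

/-- An entire function is divisible by another one with simple zeros, at which it vanishes. -/
theorem exists_entire_quotient {f d : ℂ → ℂ} (hf : Differentiable ℂ f) (hd : Differentiable ℂ d)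
    (h : ∀ x, d x = 0 → f x = 0 ∧ deriv d x ≠ 0) :
    ∃ g : ℂ → ℂ, Differentiable ℂ g ∧ ∀ x, f x = g x * d x := by
  classical
  -- At the zeros of d the quotient takes its l'Hôpital value; near such a zero it is the quotient
  -- of the two `dslope`s.
  refine ⟨fun x => if d x = 0 then deriv f x / deriv d x else f x / d x, fun x => ?_, fun x => ?_⟩
  · by_cases hx : d x = 0
    · obtain ⟨hfx, hdx⟩ := h x hx
      have h1 : DifferentiableAt ℂ (dslope f x) x :=
        (differentiableOn_dslope Filter.univ_mem).2 hf.differentiableOn |>.differentiableAt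
          Filter.univ_mem
      have h2 : DifferentiableAt ℂ (dslope d x) x :=
        (differentiableOn_dslope Filter.univ_mem).2 hd.differentiableOn |>.differentiableAt
          Filter.univ_mem
      have h3 : dslope d x x ≠ 0 := by rwa [dslope_same]
      refine (h1.div h2 h3).congr_of_eventuallyEq ?_
      filter_upwards [h2.continuousAt.eventually_ne h3] with y hy
      rcases eq_or_ne y x with rfl | hne
      · simp [hx]
      · rw [dslope_of_ne _ hne] at hy
        have hsub : y - x ≠ 0 := sub_ne_zero.2 hne
        have hdy : d y ≠ 0 := by
          intro h0
          apply hy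
          simp [slope_def_field, h0, hx]
        simp only [hdy, if_false, Pi.div_apply, dslope_of_ne _ hne, slope_def_field, hfx, hx,
          sub_zero]
        field_simp
    · refine ((hf x).div (hd x) hx).congr_of_eventuallyEq ?_
      filter_upwards [(hd x).continuousAt.eventually_ne hx] with y hy
      simp [hy]
  · by_cases hx : d x = 0
    · simp [hx, (h x hx).1]
    · simp [hx]

theorem eq_of_doubly_periodic {a : ℂ} (ha : 0 < a.re) {f : ℂ → ℂ} (hf : Differentiable ℂ f)
    (h1 : ∀ x, f (x + 1) = f x) (h2 : ∀ x, f (x + I * a) = f x) (x y : ℂ) : f x = f y := by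
  refine hf.apply_eq_apply_of_bounded ?_ x y
  refine ((isCompact_closedBall (0 : ℂ) (1 + ‖a‖)).image hf.continuous).isBounded.subset ?_
  rintro _ ⟨x, rfl⟩
  -- Since Im(ia) = Re a > 0, the numbers 1 and ia form a real basis of ℂ; taking fractional parts
  -- of the coordinates moves x into a compact set.
  set β : ℝ := x.im / a.re with hβ
  set α : ℝ := (x - β * (I * a)).re with hα
  have hx : x = α + β * (I * a) := by
    apply Complex.ext
    · simp [hα]
    · simp [hβ, ha.ne']
  have hp1 : Function.Periodic f 1 := h1
  have hp2 : Function.Periodic f (I * a) := h2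
  refine ⟨(Int.fract α : ℝ) + (Int.fract β : ℝ) * (I * a), ?_, ?_⟩
  · rw [mem_closedBall_zero_iff]
    refine (norm_add_le _ _).trans ?_
    have e1 : ‖((Int.fract α : ℝ) : ℂ)‖ ≤ 1 := by
      rw [Complex.norm_real, Real.norm_eq_abs, abs_of_nonneg (Int.fract_nonneg _)]
      exact (Int.fract_lt_one _).le
    have e2 : ‖((Int.fract β : ℝ) : ℂ)‖ ≤ 1 := by
      rw [Complex.norm_real, Real.norm_eq_abs, abs_of_nonneg (Int.fract_nonneg _)]
      exact (Int.fract_lt_one _).le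
    rw [norm_mul, norm_mul, norm_I, one_mul]
    gcongr
    calc _ ≤ 1 * ‖a‖ := by gcongr
      _ = ‖a‖ := one_mul _
  · have e3 := hp1.int_mul ⌊α⌋ ((Int.fract α : ℝ) + (Int.fract β : ℝ) * (I * a))
    have e4 := hp2.int_mul ⌊β⌋ (((Int.fract α : ℝ) : ℂ) + (Int.fract β : ℝ) * (I * a) + ⌊α⌋ * 1)
    rw [← e3, ← e4]
    congr 1
    conv_rhs => rw [hx]
    have f1 : (α : ℂ) = (Int.fract α : ℝ) + ⌊α⌋ := by
      exact_mod_cast (Int.fract_add_floor α).symm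
    have f2 : (β : ℂ) = (Int.fract β : ℝ) + ⌊β⌋ := by
      exact_mod_cast (Int.fract_add_floor β).symm
    rw [f1, f2]
    ring

/-! ### The odd theta function and its Plücker relation -/

/-- The odd theta function with simple zeros at the points of `ℤ + iaℤ`. -/
def theta (a x : ℂ) : ℂ := exp (-(Real.pi * I * x)) * R a (x - I * a / 2)

theorem differentiable_theta {a : ℂ} (ha : 0 < a.re) : Differentiable ℂ (theta a) := by
  have h := (differentiable_R ha).comp (differentiable_id.sub_const (I * a / 2))
  unfold theta
  exact Differentiable.mul (by fun_prop) h

theorem continuous_theta_comp {a : ℂ} (ha : 0 < a.re) {g : ℂ → ℂ} (hg : Continuous g) :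
    Continuous fun x => theta a (g x) :=
  (differentiable_theta ha).continuous.comp hg

theorem theta_neg {a : ℂ} (ha : 0 < a.re) (x : ℂ) : theta a (-x) = -theta a x := by
  have h := R_add_half ha x
  rw [theta, theta, show -x - I * a / 2 = -(x + I * a / 2) by ring, R_neg, h,
    show -(Real.pi * I * -x : ℂ) = Real.pi * I * x by ring]
  have : exp (Real.pi * I * x) * exp (-(2 * Real.pi * I * x)) = exp (-(Real.pi * I * x)) := by
    rw [← exp_add]; congr 1; ring
  rw [← this]; ring

theorem theta_zero {a : ℂ} (ha : 0 < a.re) : theta a 0 = 0 := by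
  have h := theta_neg ha 0
  rw [neg_zero] at h
  linear_combination h / 2

theorem R_eq_theta {a : ℂ} (w : ℂ) :
    R a w = exp (Real.pi * I * (w + I * a / 2)) * theta a (w + I * a / 2) := by
  rw [theta, ← mul_assoc, ← exp_add]
  simp

theorem theta_add_lattice {a : ℂ} (ha : 0 < a.re) (m n : ℤ) (x : ℂ) :
    theta a (x + (m + n * (I * a))) =
      exp (-(Real.pi * I * (m + n * (I * a)))) * mult a n (x - I * a / 2) * theta a x := by
  rw [theta, theta, show x + (m + n * (I * a)) - I * a / 2 = x - I * a / 2 + (m + n * (I * a)) by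
    ring, R_add_lattice ha, mul_add, neg_add, exp_add]
  ring

theorem exists_of_theta_eq_zero {a : ℂ} (ha : 0 < a.re) {x : ℂ} (h : theta a x = 0) :
    ∃ m n : ℤ, x = m + n * (I * a) := by
  obtain ⟨m, n, hmn⟩ := exists_of_R_eq_zero ha ((mul_eq_zero.1 h).resolve_left (exp_ne_zero _))
  refine ⟨m, n + 1, ?_⟩
  push_cast
  linear_combination hmn

theorem deriv_theta_ne_zero {a : ℂ} (ha : 0 < a.re) {x : ℂ} (h : theta a x = 0) :
    deriv (theta a) x ≠ 0 := by
  have h0 := (mul_eq_zero.1 h).resolve_left (exp_ne_zero _)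
  have h1 : HasDerivAt (fun x : ℂ => exp (-(Real.pi * I * x)))
      (exp (-(Real.pi * I * x)) * -(Real.pi * I)) x := by
    have := (((hasDerivAt_id x).const_mul (Real.pi * I : ℂ)).neg).cexp
    simpa using this
  have h2 := (differentiable_R ha (x - I * a / 2)).hasDerivAt.comp x
    ((hasDerivAt_id x).sub_const (I * a / 2))
  have h3 := (h1.mul h2).deriv
  have h4 : theta a = (fun x : ℂ => exp (-(Real.pi * I * x))) *
      (R a ∘ fun x => id x - I * a / 2) := rfl
  rw [h4, h3]
  simp only [Function.comp_apply, id_eq, h0, mul_zero, zero_add, mul_one]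
  exact mul_ne_zero (exp_ne_zero _) (deriv_R_ne_zero ha h0)

theorem countable_theta_zeros {a : ℂ} (ha : 0 < a.re) : {z | theta a z = 0}.Countable := by
  refine (Set.countable_range fun p : ℤ × ℤ => (p.1 + p.2 * (I * a) : ℂ)).mono ?_
  intro z hz
  obtain ⟨m, n, h⟩ := exists_of_theta_eq_zero ha hz
  exact ⟨(m, n), h.symm⟩

/-- The alternating form `θ(x + y) θ(x - y)`. -/
def bracket (a x y : ℂ) : ℂ := theta a (x + y) * theta a (x - y)

theorem bracket_swap {a : ℂ} (ha : 0 < a.re) (x y : ℂ) : bracket a x y = -bracket a y x := by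
  rw [bracket, bracket, show x - y = -(y - x) by ring, theta_neg ha, add_comm]
  ring

theorem bracket_self {a : ℂ} (ha : 0 < a.re) (x : ℂ) : bracket a x x = 0 := by
  simp [bracket, theta_zero ha]

theorem bracket_neg_left {a : ℂ} (ha : 0 < a.re) (x y : ℂ) : bracket a (-x) y = bracket a x y := by
  rw [bracket, bracket, show -x + y = -(x - y) by ring, show -x - y = -(x + y) by ring,
    theta_neg ha, theta_neg ha]
  ring

theorem bracket_add_lattice {a : ℂ} (ha : 0 < a.re) (m n : ℤ) (x : ℂ) :
    ∃ c : ℂ, c ≠ 0 ∧ ∀ y, bracket a (x + (m + n * (I * a))) y = c * bracket a x y := by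
  refine ⟨exp (-(Real.pi * I * (m + n * (I * a)))) ^ 2 * mult a n (x - I * a / 2) ^ 2,
    mul_ne_zero (pow_ne_zero _ (exp_ne_zero _)) (pow_ne_zero _ (mult_ne_zero _ _ _)),
    fun y => ?_⟩
  have h : mult a n (x + y - I * a / 2) * mult a n (x - y - I * a / 2) =
      mult a n (x - I * a / 2) ^ 2 := by
    simp only [mult]
    rw [← exp_add, ← exp_nat_mul]
    congr 1
    push_cast
    ring
  rw [bracket, bracket, show x + (m + n * (I * a)) + y = x + y + (m + n * (I * a)) by ring,
    show x + (m + n * (I * a)) - y = x - y + (m + n * (I * a)) by ring, theta_add_lattice ha,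
    theta_add_lattice ha, ← h]
  ring

/-- As a function of x, the left side and `bracket a x v` have the same lattice multipliers, and the
left side vanishes at x ≡ ±v. These are simple zeros of the bracket because θ(2v) ≠ 0. The quotient
is therefore entire and doubly periodic, hence constant, and it vanishes at x = u. -/
theorem bracket_plucker_of_ne_zero {a : ℂ} (ha : 0 < a.re) (x y u v : ℂ)
    (h1 : theta a (2 * v) ≠ 0) (h2 : bracket a u v ≠ 0) :
    bracket a x y * bracket a u v + bracket a x u * bracket a v y +
      bracket a x v * bracket a y u = 0 := by
  have hθ := differentiable_theta ha
  have hbr : ∀ y, Differentiable ℂ fun x => bracket a x y := fun y =>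
    (hθ.comp (differentiable_id.add_const y)).mul (hθ.comp (differentiable_id.sub_const y))
  set f : ℂ → ℂ := fun x => bracket a x y * bracket a u v + bracket a x u * bracket a v y +
      bracket a x v * bracket a y u with hf
  have hfd : Differentiable ℂ f :=
    (((hbr y).mul_const _).add ((hbr u).mul_const _)).add ((hbr v).mul_const _)
  have hfv : f v = 0 := by
    simp only [hf, bracket_self ha, bracket_swap ha v u]; ring
  have hfu : f u = 0 := by
    simp only [hf, bracket_self ha, bracket_swap ha u y, bracket_swap ha u v]; ring
  have hfneg : ∀ x, f (-x) = f x := fun x => by simp only [hf, bracket_neg_left ha]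
  have hflat : ∀ (m n : ℤ) (x : ℂ), f x = 0 → f (x + (m + n * (I * a))) = 0 := by
    intro m n x hx
    obtain ⟨c, -, hc⟩ := bracket_add_lattice ha m n x
    have : f (x + (m + n * (I * a))) = c * f x := by
      simp only [hf, hc]; ring
    rw [this, hx, mul_zero]
  have hzero : ∀ x, theta a (x + v) = 0 → f x = 0 ∧ theta a (x - v) ≠ 0 := by
    intro x hx
    obtain ⟨m, n, hmn⟩ := exists_of_theta_eq_zero ha hx
    have hx' : x = -v + (m + n * (I * a)) := by linear_combination hmn
    refine ⟨?_, ?_⟩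
    · rw [hx']; exact hflat m n _ (by rw [hfneg, hfv])
    · rw [hx', show -v + (m + n * (I * a)) - v = -(2 * v) + (m + n * (I * a)) by ring,
        theta_add_lattice ha, theta_neg ha]
      exact mul_ne_zero (mul_ne_zero (exp_ne_zero _) (mult_ne_zero _ _ _)) (neg_ne_zero.2 h1)
  have hzero' : ∀ x, theta a (x - v) = 0 → f x = 0 ∧ theta a (x + v) ≠ 0 := by
    intro x hx
    have h := hzero (-x) (by rw [show -x + v = -(x - v) by ring, theta_neg ha, hx, neg_zero])
    refine ⟨by rw [← hfneg]; exact h.1, fun h0 => h.2 ?_⟩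
    rw [show -x - v = -(x + v) by ring, theta_neg ha, h0, neg_zero]
  obtain ⟨g, hg, hfg⟩ := exists_entire_quotient hfd (hbr v) (by
    intro x hx
    have hd : HasDerivAt (fun x => bracket a x v)
        (deriv (theta a) (x + v) * theta a (x - v) + theta a (x + v) * deriv (theta a) (x - v))
        x := by
      have e1 := (hθ (x + v)).hasDerivAt.comp x ((hasDerivAt_id x).add_const v)
      have e2 := (hθ (x - v)).hasDerivAt.comp x ((hasDerivAt_id x).sub_const v)
      simpa [Function.comp_def, Pi.mul_def, bracket] using e1.mul e2
    rw [hd.deriv]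
    rcases mul_eq_zero.1 hx with h | h
    · refine ⟨(hzero x h).1, ?_⟩
      rw [h, zero_mul, add_zero]
      exact mul_ne_zero (deriv_theta_ne_zero ha h) (hzero x h).2
    · refine ⟨(hzero' x h).1, ?_⟩
      rw [h, mul_zero, zero_add]
      exact mul_ne_zero (hzero' x h).2 (deriv_theta_ne_zero ha h))
  have hdc : {x | bracket a x v = 0}.Countable := by
    have c1 := countable_zeros_comp_mul_add (countable_theta_zeros ha) one_ne_zero v
    have c2 := countable_zeros_comp_mul_add (countable_theta_zeros ha) one_ne_zero (-v)
    refine (c1.union c2).mono fun x hx => ?_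
    rcases mul_eq_zero.1 hx with h | h
    · left; simpa using h
    · right; simpa [sub_eq_add_neg] using h
  have hper : ∀ (m n : ℤ) (x : ℂ), g (x + (m + n * (I * a))) = g x := by
    intro m n x
    refine sub_eq_zero.1 (eq_zero_of_countable
      (f := fun x => g (x + (m + n * (I * a))) - g x) ?_ hdc (fun x hx => ?_) x)
    · exact (hg.continuous.comp (by fun_prop)).sub hg.continuous
    · obtain ⟨c, hc0, hc⟩ := bracket_add_lattice ha m n x
      have e1 := hfg (x + (m + n * (I * a)))
      have e2 : f (x + (m + n * (I * a))) = c * f x := by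
        simp only [hf, hc]; ring
      rw [e2, hc, hfg] at e1
      have hx' : bracket a x v ≠ 0 := hx
      apply mul_left_cancel₀ (mul_ne_zero hc0 hx')
      linear_combination -e1
  have hconst := eq_of_doubly_periodic ha hg (fun x => by simpa using hper 1 0 x)
    (fun x => by simpa using hper 0 1 x) x u
  have hgu : g u = 0 := by
    have := hfg u
    rw [hfu] at this
    exact (mul_eq_zero.1 this.symm).resolve_right h2
  have := hfg x
  rwa [hconst, hgu, zero_mul] at this

/-- The Weierstrass addition formula. -/
theorem bracket_plucker {a : ℂ} (ha : 0 < a.re) (x y u v : ℂ) :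
    bracket a x y * bracket a u v + bracket a x u * bracket a v y +
      bracket a x v * bracket a y u = 0 := by
  have hc := countable_theta_zeros ha
  -- The exceptional v, with θ(2v) = 0 or θ(u + v)θ(u - v) = 0, are countable, and the identity is
  -- continuous in v.
  have c1 := countable_zeros_comp_mul_add hc two_ne_zero 0
  have c2 := countable_zeros_comp_mul_add hc one_ne_zero u
  have c3 := countable_zeros_comp_mul_add hc (neg_ne_zero.2 one_ne_zero) u
  refine eq_zero_of_countable (f := fun v => bracket a x y * bracket a u v +
    bracket a x u * bracket a v y + bracket a x v * bracket a y u) ?_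
    ((c1.union c2).union c3) (fun v hv => ?_) v
  · unfold bracket
    have := fun g hg => @continuous_theta_comp a ha g hg
    refine .add (.add (.mul continuous_const (.mul (this _ ?_) (this _ ?_)))
      (.mul continuous_const (.mul (this _ ?_) (this _ ?_))))
      (.mul (.mul (this _ ?_) (this _ ?_)) continuous_const) <;> fun_prop
  · simp only [Set.mem_union, Set.mem_ofPred_eq, not_or, add_zero, one_mul, neg_mul] at hv
    refine bracket_plucker_of_ne_zero ha x y u v hv.1.1 (mul_ne_zero ?_ ?_)
    · rw [add_comm]; exact hv.1.2
    · rw [sub_eq_add_neg, add_comm]; exact hv.2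

/-! ### The four-term theta identity behind the kernel identities. -/

/-- By `bracket_plucker`, all brackets with β are combinations of those at z ± t, and all brackets
with β' are combinations of those at y ± t. The divisors of these expansions are θ(2z)θ(2t) and
θ(2y)θ(2t). Substituting both expansions leaves a polynomial identity in theta values. -/
theorem theta_four_term_of_ne_zero {a : ℂ} (ha : 0 < a.re) (z y t t' β β' : ℂ)
    (hz : theta a (2 * z) ≠ 0) (ht : theta a (2 * t) ≠ 0) :
    theta a (2 * y) * (theta a (z + y - (t + t')) * theta a (z - y - (t + t')) *
        bracket a (z + t) β * bracket a (z + t') β' -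
      theta a (z - y + (t + t')) * theta a (z + y + (t + t')) *
        bracket a (z - t) β * bracket a (z - t') β') =
    theta a (2 * z) * (-(theta a (z + y - (t + t')) * theta a (z - y + (t + t')) *
        bracket a (y + t') β * bracket a (y + t) β') +
      theta a (z - y - (t + t')) * theta a (z + y + (t + t')) *
        bracket a (y - t') β * bracket a (y - t) β') := by
  have hAB : bracket a (z + t) (z - t) = theta a (2 * z) * theta a (2 * t) := by
    rw [bracket]; ring_nf
  have hCD : bracket a (y + t) (y - t) = theta a (2 * y) * theta a (2 * t) := by
    rw [bracket]; ring_nf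
  have hCA : bracket a (y + t') (z + t) = -(theta a (z + y + (t + t')) *
      theta a (z - y + t - t')) := by
    rw [bracket, show y + t' - (z + t) = -(z - y + t - t') by ring, theta_neg ha,
      show y + t' + (z + t) = z + y + (t + t') by ring]; ring
  have hDA : bracket a (y - t') (z + t) = -(theta a (z + y + t - t') *
      theta a (z - y + (t + t'))) := by
    rw [bracket, show y - t' - (z + t) = -(z - y + (t + t')) by ring, theta_neg ha,
      show y - t' + (z + t) = z + y + t - t' by ring]; ring
  have hCB : bracket a (y + t') (z - t) = -(theta a (z + y - t + t') *
      theta a (z - y - (t + t'))) := by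
    rw [bracket, show y + t' - (z - t) = -(z - y - (t + t')) by ring, theta_neg ha,
      show y + t' + (z - t) = z + y - t + t' by ring]; ring
  have hDB : bracket a (y - t') (z - t) = -(theta a (z + y - (t + t')) *
      theta a (z - y - t + t')) := by
    rw [bracket, show y - t' - (z - t) = -(z - y - t + t') by ring, theta_neg ha,
      show y - t' + (z - t) = z + y - (t + t') by ring]; ring
  have hBC' : bracket a (z - t') (y + t) = theta a (z + y + t - t') *
      theta a (z - y - (t + t')) := by
    rw [bracket]; ring_nf
  have hBD' : bracket a (z - t') (y - t) = theta a (z + y - (t + t')) *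
      theta a (z - y + t - t') := by
    rw [bracket]; ring_nf
  have hAC' : bracket a (z + t') (y + t) = theta a (z + y + (t + t')) *
      theta a (z - y - t + t') := by
    rw [bracket]; ring_nf
  have hAD' : bracket a (z + t') (y - t) = theta a (z + y - t + t') *
      theta a (z - y + (t + t')) := by
    rw [bracket]; ring_nf
  have pB := bracket_plucker ha (z - t') β' (y + t) (y - t)
  have pA := bracket_plucker ha (z + t') β' (y + t) (y - t)
  rw [hCD, hBC', hBD', bracket_swap ha β'] at pB
  rw [hCD, hAC', hAD', bracket_swap ha β'] at pA
  have qA := bracket_plucker ha (z + t) β (z + t) (z - t)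
  have qB := bracket_plucker ha (z - t) β (z + t) (z - t)
  have qC := bracket_plucker ha (y + t') β (z + t) (z - t)
  have qD := bracket_plucker ha (y - t') β (z + t) (z - t)
  rw [bracket_self ha, hAB] at qA
  rw [bracket_self ha, bracket_swap ha (z - t) (z + t), hAB] at qB
  rw [hAB, hCA, hCB] at qC
  rw [hAB, hDA, hDB] at qD
  apply mul_left_cancel₀ (mul_ne_zero hz ht)
  generalize theta a (2 * z) = z2 at *
  generalize theta a (2 * y) = y2 at *
  generalize theta a (2 * t) = t2 at *
  generalize theta a (z + y - (t + t')) = e1 at *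
  generalize theta a (z - y - (t + t')) = e2 at *
  generalize theta a (z - y + (t + t')) = e3 at *
  generalize theta a (z + y + (t + t')) = e4 at *
  generalize theta a (z - y + t - t') = e5 at *
  generalize theta a (z + y + t - t') = e6 at *
  generalize theta a (z + y - t + t') = e7 at *
  generalize theta a (z - y - t + t') = e8 at *
  generalize bracket a (z + t') β' = A' at *
  generalize bracket a (z - t') β' = B' at *
  generalize bracket a (y + t) β' = C' at *
  generalize bracket a (y - t) β' = D' at *
  linear_combination (y2 * e1 * e2 * A') * qA - (y2 * e3 * e4 * B') * qB +
    (z2 * e1 * e3 * C') * qC - (z2 * e2 * e4 * D') * qD -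
    (z2 * e3 * e4 * bracket a (z - t) β) * pB - (z2 * e1 * e2 * bracket a β (z + t)) * pA

theorem theta_four_term {a : ℂ} (ha : 0 < a.re) (z y t t' β β' : ℂ)
    (hz : theta a (2 * z) ≠ 0) :
    theta a (2 * y) * (theta a (z + y - (t + t')) * theta a (z - y - (t + t')) *
        bracket a (z + t) β * bracket a (z + t') β' -
      theta a (z - y + (t + t')) * theta a (z + y + (t + t')) *
        bracket a (z - t) β * bracket a (z - t') β') =
    theta a (2 * z) * (-(theta a (z + y - (t + t')) * theta a (z - y + (t + t')) *
        bracket a (y + t') β * bracket a (y + t) β') +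
      theta a (z - y - (t + t')) * theta a (z + y + (t + t')) *
        bracket a (y - t') β * bracket a (y - t) β') := by
  -- Fixing the sum g = t + t' leaves t as a free variable, so the zeros of θ(2t) are removed by
  -- continuity.
  obtain ⟨g, rfl⟩ : ∃ g, t' = g - t := ⟨t + t', by ring⟩
  rw [show t + (g - t) = g by ring]
  have hb : ∀ {f g : ℂ → ℂ}, Continuous f → Continuous g →
      Continuous fun x => bracket a (f x) (g x) := fun hf hg =>
    (continuous_theta_comp ha (hf.add hg)).mul (continuous_theta_comp ha (hf.sub hg))
  refine sub_eq_zero.1 (eq_zero_of_countable (f := fun t =>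
    theta a (2 * y) * (theta a (z + y - g) * theta a (z - y - g) *
        bracket a (z + t) β * bracket a (z + (g - t)) β' -
      theta a (z - y + g) * theta a (z + y + g) *
        bracket a (z - t) β * bracket a (z - (g - t)) β') -
    theta a (2 * z) * (-(theta a (z + y - g) * theta a (z - y + g) *
        bracket a (y + (g - t)) β * bracket a (y + t) β') +
      theta a (z - y - g) * theta a (z + y + g) *
        bracket a (y - (g - t)) β * bracket a (y - t) β')) ?_
    (countable_zeros_comp_mul_add (countable_theta_zeros ha) two_ne_zero 0) (fun t ht => ?_) t)
  · have h1 : ∀ x, Continuous fun t => bracket a (x + t) β := fun x => hb (by fun_prop) (by fun_prop)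
    have h2 : ∀ x, Continuous fun t => bracket a (x - t) β := fun x => hb (by fun_prop) (by fun_prop)
    have h3 : ∀ x, Continuous fun t => bracket a (x + t) β' := fun x => hb (by fun_prop) (by fun_prop)
    have h4 : ∀ x, Continuous fun t => bracket a (x - t) β' := fun x => hb (by fun_prop) (by fun_prop)
    have h5 : ∀ x, Continuous fun t => bracket a (x + (g - t)) β := fun x => hb (by fun_prop) (by fun_prop)
    have h6 : ∀ x, Continuous fun t => bracket a (x - (g - t)) β := fun x => hb (by fun_prop) (by fun_prop)
    have h7 : ∀ x, Continuous fun t => bracket a (x + (g - t)) β' := fun x => hb (by fun_prop) (by fun_prop)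
    have h8 : ∀ x, Continuous fun t => bracket a (x - (g - t)) β' := fun x => hb (by fun_prop) (by fun_prop)
    exact (continuous_const.mul (((continuous_const.mul (h1 _)).mul (h7 _)).sub
      ((continuous_const.mul (h2 _)).mul (h8 _)))).sub
      (continuous_const.mul (((continuous_const.mul (h5 _)).mul (h3 _)).neg.add
      ((continuous_const.mul (h6 _)).mul (h4 _))))
  · have := theta_four_term_of_ne_zero ha z y t (g - t) β β' hz (by simpa using ht)
    rw [show t + (g - t) = g by ring] at this
    exact sub_eq_zero.2 this

theorem R_four_term {a : ℂ} (ha : 0 < a.re) (c : Fin 4 → ℂ) (γ z y : ℂ)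
    (hc : ∑ n, c n = 2 * γ - I * a)
    (hz : R a (2 * z - I * a / 2) ≠ 0) (hy : R a (2 * y - I * a / 2) ≠ 0) :
    (∏ n, R a (z + c n)) / R a (2 * z - I * a / 2) * (R a (z + y - γ) * R a (z - y - γ)) +
      (∏ n, R a (-z + c n)) / R a (2 * (-z) - I * a / 2) *
        (R a (-z + y - γ) * R a (-z - y - γ)) =
    (∏ n, R a (y + (γ - I * a / 2 - c n))) / R a (2 * y - I * a / 2) *
        (R a (y + z - γ) * R a (y - z - γ)) +
      (∏ n, R a (-y + (γ - I * a / 2 - c n))) / R a (2 * (-y) - I * a / 2) *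
        (R a (-y + z - γ) * R a (-y - z - γ)) := by
  set g := γ - I * a / 2 with hg
  -- Two factors R are written with θ shifted by +ia/2 and two with -ia/2. The exponential
  -- prefactors in x then cancel, and the constant κ does not depend on x.
  set t := (c 0 + c 1 + I * a) / 2 with ht
  set t' := (c 2 + c 3 - I * a) / 2 with ht'
  set β := (c 0 - c 1) / 2 with hβ
  set β' := (c 2 - c 3) / 2 with hβ'
  set κ := exp (Real.pi * I * (c 0 + c 1 - c 2 - c 3 + 2 * (I * a))) with hκ
  have htg : t + t' = g := by
    rw [Fin.sum_univ_four] at hc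
    rw [ht, ht', hg]
    linear_combination hc / 2
  have hprod : ∀ x, ∏ n, R a (x + c n) = κ * (bracket a (x + t) β * bracket a (x + t') β') := by
    intro x
    have hR : ∀ w, R a w = -exp (-(Real.pi * I * (w - I * a / 2))) * theta a (w - I * a / 2) := by
      intro w
      rw [← R_neg, R_eq_theta, show -w + I * a / 2 = -(w - I * a / 2) by ring, theta_neg ha,
        mul_neg (Real.pi * I : ℂ)]
      ring
    rw [Fin.prod_univ_four, R_eq_theta (x + c 0), R_eq_theta (x + c 1), hR (x + c 2),
      hR (x + c 3), bracket, bracket]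
    rw [show x + t + β = x + c 0 + I * a / 2 by rw [ht, hβ]; ring,
      show x + t - β = x + c 1 + I * a / 2 by rw [ht, hβ]; ring,
      show x + t' + β' = x + c 2 - I * a / 2 by rw [ht', hβ']; ring,
      show x + t' - β' = x + c 3 - I * a / 2 by rw [ht', hβ']; ring]
    have : κ = exp (Real.pi * I * (x + c 0 + I * a / 2)) * exp (Real.pi * I * (x + c 1 + I * a / 2)) *
        exp (-(Real.pi * I * (x + c 2 - I * a / 2))) *
          exp (-(Real.pi * I * (x + c 3 - I * a / 2))) := by
      rw [hκ, ← exp_add, ← exp_add, ← exp_add]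
      congr 1
      ring
    rw [this]; ring
  have hprod' : ∀ x, ∏ n, R a (x + (g - c n)) =
      κ * (bracket a (-x - g + t) β * bracket a (-x - g + t') β') := by
    intro x
    rw [← hprod]
    refine Finset.prod_congr rfl fun n _ => ?_
    rw [← R_neg]
    ring_nf
  have hquot : ∀ x w P, P / R a (2 * x - I * a / 2) * (R a (x + w - γ) * R a (x - w - γ)) =
      exp (-(2 * Real.pi * I * g)) * (P * (theta a (x + w - g) * theta a (x - w - g)) /
        theta a (2 * x)) := by
    intro x w P
    rw [R_eq_theta (x + w - γ), R_eq_theta (x - w - γ), R_eq_theta (2 * x - I * a / 2)]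
    rw [show x + w - γ + I * a / 2 = x + w - g by rw [hg]; ring,
      show x - w - γ + I * a / 2 = x - w - g by rw [hg]; ring,
      show 2 * x - I * a / 2 + I * a / 2 = 2 * x by ring]
    have : exp (-(2 * Real.pi * I * g)) * exp (Real.pi * I * (2 * x)) =
        exp (Real.pi * I * (x + w - g)) * exp (Real.pi * I * (x - w - g)) := by
      rw [← exp_add, ← exp_add]; congr 1; ring
    rw [div_mul_eq_mul_div, mul_div_assoc', ← div_div]
    congr 1
    rw [div_eq_iff (exp_ne_zero _)]
    linear_combination (-(P * theta a (x + w - g) * theta a (x - w - g))) * this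
  have hz' : theta a (2 * z) ≠ 0 := fun h => hz (by
    rw [R_eq_theta, show 2 * z - I * a / 2 + I * a / 2 = 2 * z by ring, h, mul_zero])
  have hy' : theta a (2 * y) ≠ 0 := fun h => hy (by
    rw [R_eq_theta, show 2 * y - I * a / 2 + I * a / 2 = 2 * y by ring, h, mul_zero])
  have main := theta_four_term ha z y t t' β β' hz'
  rw [htg] at main
  rw [hquot z y, hquot (-z) y, hquot y z, hquot (-y) z, hprod, hprod, hprod', hprod',
    ← mul_add, ← mul_add]
  congr 1
  have n1 : ∀ x, theta a (2 * -x) = -theta a (2 * x) := fun x => by rw [mul_neg, theta_neg ha]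
  rw [n1, n1, show -z + y - g = -(z - y + g) by ring, show -z - y - g = -(z + y + g) by ring,
    show y - z - g = -(z - y + g) by ring, show -y - z - g = -(z + y + g) by ring,
    show y + z - g = z + y - g by ring, show -y + z - g = z - y - g by ring,
    show -z + t = -(z - t) by ring, show -z + t' = -(z - t') by ring,
    show -y - g + t = -(y + t') by rw [← htg]; ring,
    show -y - g + t' = -(y + t) by rw [← htg]; ring,
    show - -y - g + t = y - t' by rw [← htg]; ring,
    show - -y - g + t' = y - t by rw [← htg]; ring]
  simp only [bracket_neg_left ha]
  simp only [theta_neg ha]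
  generalize theta a (2 * z) = z2 at *
  generalize theta a (2 * y) = y2 at *
  field_simp
  linear_combination κ * main

/-- `l'` is the image of `l` under the reversal attached to the kernel with parameter `γ`,
up to integer shifts. -/
def IsReflection (a : Bool → ℂ) (γ : ℂ) (l l' : Fin 4 → ℂ) : Prop :=
  (∃ m : ℤ, 2 * γ = I * (a true + a false) + (∑ n, l n) + m) ∧
    ∀ n, ∃ k : ℤ, l' n = γ - I * (a true + a false) / 2 - l n + k

theorem add_not (a : Bool → ℂ) (δ : Bool) : a true + a false = a δ + a (!δ) := by
  cases δ <;> simp [add_comm]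

theorem coeff_eq_of_int {a : Bool → ℂ} {δ : Bool} {l l' : Fin 4 → ℂ}
    (h : ∀ n, ∃ k : ℤ, l' n = l n + k) (z : ℂ) : coeff a δ l' z = coeff a δ l z := by
  rw [coeff, coeff]
  congr 1
  refine Finset.prod_congr rfl fun n _ => ?_
  obtain ⟨k, hk⟩ := h n
  rw [hk, show z + (l n + k) + I * a (!δ) / 4 = z + l n + I * a (!δ) / 4 + k by ring, R_add_int]

theorem coeff_four_term {a : Bool → ℂ} (ha : ∀ δ, 0 < (a δ).re) (δ : Bool) {l l' : Fin 4 → ℂ}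
    {γ : ℂ} (hl : IsReflection a γ l l') {z y : ℂ} (hz : CoeffRegular a δ z)
    (hy : CoeffRegular a δ y) :
    coeff a δ l z * (R (a δ) (z + y - γ) * R (a δ) (z - y - γ)) +
      coeff a δ l (-z) * (R (a δ) (-z + y - γ) * R (a δ) (-z - y - γ)) =
    coeff a δ l' y * (R (a δ) (y + z - γ) * R (a δ) (y - z - γ)) +
      coeff a δ l' (-y) * (R (a δ) (-y + z - γ) * R (a δ) (-y - z - γ)) := by
  obtain ⟨⟨m, hm⟩, hk⟩ := hl
  -- The integer m is absorbed into one coordinate, so that the sum condition holds exactly; R does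
  -- not see integer shifts.
  set e : Fin 4 → ℤ := fun n => if n = 0 then m else 0 with he
  have main := R_four_term (ha δ) (fun n => l n + I * a (!δ) / 4 + e n) γ z y (by
    rw [add_not a δ] at hm
    simp only [Finset.sum_add_distrib, he]
    rw [hm]
    simp
    ring) hz.1 hy.1
  have h1 : ∀ x, ∏ n, R (a δ) (x + (l n + I * a (!δ) / 4 + e n)) =
      ∏ n, R (a δ) (x + l n + I * a (!δ) / 4) := by
    intro x
    refine Finset.prod_congr rfl fun n _ => ?_
    rw [← add_assoc, ← add_assoc, R_add_int]
  have h2 : ∀ x, ∏ n, R (a δ) (x + (γ - I * a δ / 2 - (l n + I * a (!δ) / 4 + e n))) =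
      ∏ n, R (a δ) (x + l' n + I * a (!δ) / 4) := by
    intro x
    refine Finset.prod_congr rfl fun n _ => ?_
    obtain ⟨k, hk⟩ := hk n
    rw [hk, add_not a δ, show x + (γ - I * a δ / 2 - (l n + I * a (!δ) / 4 + e n)) =
      x + (γ - I * (a δ + a (!δ)) / 2 - l n) + I * a (!δ) / 4 + (-e n : ℤ) by push_cast; ring,
      show x + (γ - I * (a δ + a (!δ)) / 2 - l n + k) + I * a (!δ) / 4 =
      x + (γ - I * (a δ + a (!δ)) / 2 - l n) + I * a (!δ) / 4 + k by ring, R_add_int, R_add_int]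
  rw [h1, h1, h2, h2] at main
  exact main

/-! ### The double product and the difference equation of G. -/

/-- The double product `∏_{m,n ≥ 1} (1 - q₁^(2m-1) q₂^(2n-1) w)`. -/
def doublePoch (q₁ q₂ w : ℂ) : ℂ :=
  ∏' p : ℕ × ℕ, (1 - q₁ ^ (2 * p.1 + 1) * q₂ ^ (2 * p.2 + 1) * w)

theorem summable_odd_pow {q : ℂ} (hq : ‖q‖ < 1) : Summable fun n : ℕ => ‖q ^ (2 * n + 1)‖ := by
  have h : ‖q‖ ^ 2 < 1 := pow_lt_one₀ (norm_nonneg _) hq (by omega)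
  refine ((summable_geometric_of_lt_one (by positivity) h).mul_right ‖q‖).congr fun n => ?_
  rw [norm_pow]; ring

theorem multipliable_doublePoch {q₁ q₂ : ℂ} (h₁ : ‖q₁‖ < 1) (h₂ : ‖q₂‖ < 1) (w : ℂ) :
    Multipliable fun p : ℕ × ℕ => 1 - q₁ ^ (2 * p.1 + 1) * q₂ ^ (2 * p.2 + 1) * w := by
  have hs : Summable fun p : ℕ × ℕ => ‖-(q₁ ^ (2 * p.1 + 1) * q₂ ^ (2 * p.2 + 1) * w)‖ := by
    simp only [norm_neg, norm_mul]
    exact ((summable_odd_pow h₁).mul_of_nonneg (summable_odd_pow h₂) (fun _ => norm_nonneg _)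
      (fun _ => norm_nonneg _)).mul_right ‖w‖
  simpa [sub_eq_add_neg] using multipliable_one_add_of_summable hs

theorem doublePoch_comm (q₁ q₂ w : ℂ) : doublePoch q₁ q₂ w = doublePoch q₂ q₁ w := by
  rw [doublePoch, doublePoch, ← (Equiv.prodComm ℕ ℕ).tprod_eq]
  refine tprod_congr fun p => ?_
  simp only [Equiv.prodComm_apply, Prod.fst_swap, Prod.snd_swap]
  ring

theorem doublePoch_eq {q₁ q₂ : ℂ} (h₁ : ‖q₁‖ < 1) (h₂ : ‖q₂‖ < 1) (w : ℂ) :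
    doublePoch q₁ q₂ w = ∏' m : ℕ, poch (q₂ ^ 2) (q₁ ^ (2 * m + 1) * (q₂ * w)) := by
  have h2' : ‖q₂ ^ 2‖ < 1 := by
    rw [norm_pow]; exact pow_lt_one₀ (norm_nonneg _) h₂ (by omega)
  have e : ∀ m n : ℕ, 1 - q₁ ^ (2 * m + 1) * q₂ ^ (2 * n + 1) * w =
      1 - (q₂ ^ 2) ^ n * (q₁ ^ (2 * m + 1) * (q₂ * w)) := fun m n => by ring
  rw [doublePoch, (multipliable_doublePoch h₁ h₂ w).tprod_prod' fun m => by
    simp only [e]; exact multipliable_poch h2' _]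
  refine tprod_congr fun m => tprod_congr fun n => e m n

theorem multipliable_poch_odd {q₁ q₂ : ℂ} (h₁ : ‖q₁‖ < 1) (h₂ : ‖q₂‖ < 1) (w : ℂ) :
    Multipliable fun m : ℕ => poch (q₂ ^ 2) (q₁ ^ (2 * m + 1) * (q₂ * w)) := by
  have h2' : ‖q₂ ^ 2‖ < 1 := by
    rw [norm_pow]; exact pow_lt_one₀ (norm_nonneg _) h₂ (by omega)
  have e : ∀ m n : ℕ, 1 - q₁ ^ (2 * m + 1) * q₂ ^ (2 * n + 1) * w =
      1 - (q₂ ^ 2) ^ n * (q₁ ^ (2 * m + 1) * (q₂ * w)) := fun m n => by ring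
  have := ((multipliable_doublePoch h₁ h₂ w).hasProd.prod_fiberwise fun m =>
    (by simp only [e]; exact multipliable_poch h2' _ :
      Multipliable fun n : ℕ => 1 - q₁ ^ (2 * m + 1) * q₂ ^ (2 * n + 1) * w).hasProd).multipliable
  refine this.congr fun m => ?_
  rw [poch]
  exact tprod_congr fun n => e m n

/-- Passing from w q₂ to w / q₂ lowers every exponent of q₂ by two, which adds exactly the terms
with exponent zero; these form a Pochhammer product in q₁². -/
theorem doublePoch_div {q₁ q₂ : ℂ} (h₁ : ‖q₁‖ < 1) (h₂ : ‖q₂‖ < 1) (h0 : q₂ ≠ 0) (w : ℂ) :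
    doublePoch q₁ q₂ (w / q₂) = poch (q₁ ^ 2) (q₁ * w) * doublePoch q₁ q₂ (w * q₂) := by
  have h1' : ‖q₁ ^ 2‖ < 1 := by
    rw [norm_pow]; exact pow_lt_one₀ (norm_nonneg _) h₁ (by omega)
  have h2' : ‖q₂ ^ 2‖ < 1 := by
    rw [norm_pow]; exact pow_lt_one₀ (norm_nonneg _) h₂ (by omega)
  have e : ∀ m : ℕ, 1 - (q₁ ^ 2) ^ m * (q₁ * w) = 1 - q₁ ^ (2 * m + 1) * w := fun m => by ring
  rw [doublePoch_eq h₁ h₂, doublePoch_eq h₁ h₂, poch, ← (multipliable_poch h1' _).tprod_mul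
    (multipliable_poch_odd h₁ h₂ _)]
  refine tprod_congr fun m => ?_
  rw [mul_div_cancel₀ w h0, poch_eq h2', e]
  ring_nf

theorem tprod_gammaFactor (a : Bool → ℂ) (δ : Bool) (z : ℂ) :
    ∏' p : ℕ × ℕ, gammaFactor a p z =
      doublePoch (nome (a δ)) (nome (a (!δ))) (exp (2 * Real.pi * I * z)) := by
  cases δ
  · rw [doublePoch_comm]; rfl
  · rfl

theorem tprod_gammaFactor_ne_zero {a : Bool → ℂ} (ha : ∀ δ, 0 < (a δ).re) {z : ℂ}
    (hz : GRegular a z) : ∏' p : ℕ × ℕ, gammaFactor a p z ≠ 0 := by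
  have hs : Summable fun p : ℕ × ℕ => ‖-(nome (a true) ^ (2 * p.1 + 1) *
      nome (a false) ^ (2 * p.2 + 1) * exp (2 * Real.pi * I * z))‖ := by
    simp only [norm_neg, norm_mul _ (exp _)]
    simp only [norm_mul (nome _ ^ _)]
    exact ((summable_odd_pow (norm_nome_lt_one (ha true))).mul_of_nonneg
      (summable_odd_pow (norm_nome_lt_one (ha false))) (fun _ => norm_nonneg _)
      (fun _ => norm_nonneg _)).mul_right _
  have := tprod_one_add_ne_zero_of_summable (f := fun p : ℕ × ℕ => -(nome (a true) ^ (2 * p.1 + 1) *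
      nome (a false) ^ (2 * p.2 + 1) * exp (2 * Real.pi * I * z)))
    (fun p => by simpa [gammaFactor, sub_eq_add_neg] using hz p) hs
  simpa [gammaFactor, sub_eq_add_neg] using this

theorem tprod_gammaFactor_sub_step {a : Bool → ℂ} (ha : ∀ δ, 0 < (a δ).re) (δ : Bool) (u : ℂ) :
    ∏' p : ℕ × ℕ, gammaFactor a p (u - step a δ) =
      poch (nome (a δ) ^ 2) (nome (a δ) * exp (2 * Real.pi * I * u)) *
        ∏' p : ℕ × ℕ, gammaFactor a p (u + step a δ) := by
  have h1 : exp (2 * Real.pi * I * (u - step a δ)) =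
      exp (2 * Real.pi * I * u) / nome (a (!δ)) := by
    rw [nome, ← exp_sub, step]; congr 1; linear_combination (-Real.pi * a (!δ) : ℂ) * I_sq
  have h2 : exp (2 * Real.pi * I * (u + step a δ)) =
      exp (2 * Real.pi * I * u) * nome (a (!δ)) := by
    rw [nome, ← exp_add, step]; congr 1; linear_combination (Real.pi * a (!δ) : ℂ) * I_sq
  rw [tprod_gammaFactor a δ, tprod_gammaFactor a δ, h1, h2,
    doublePoch_div (norm_nome_lt_one (ha δ)) (norm_nome_lt_one (ha (!δ))) (nome_ne_zero _)]

/-- The difference equation of the elliptic gamma function. -/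
theorem G_add_step {a : Bool → ℂ} (ha : ∀ δ, 0 < (a δ).re) (δ : Bool) {u : ℂ}
    (hu : GRegular a (u - step a δ)) :
    G a (u + step a δ) = R (a δ) u * G a (u - step a δ) := by
  have h1 := tprod_gammaFactor_sub_step ha δ u
  have h2 := tprod_gammaFactor_sub_step ha δ (-u)
  -- The denominator at u - s contains the denominator at u + s as a factor, so regularity at the
  -- lower point is enough.
  have h3 := tprod_gammaFactor_ne_zero ha hu
  rw [h1] at h3
  have h4 := left_ne_zero_of_mul h3
  have h5 := right_ne_zero_of_mul h3
  rw [G, G, h1, show -(u + step a δ) = -u - step a δ by ring, h2,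
    show -(u - step a δ) = -u + step a δ by ring, R_eq_poch (ha δ), mul_neg]
  field_simp

/-! ### The kernel identities. -/

/-- Every shifted factor G(w + s) is rewritten as R(w) G(w - s). The product of the four values G(w
- s) then factors out of all four terms, and `coeff_four_term` remains. -/
theorem kernelIdentity_of_isReflection {a : Bool → ℂ} (ha : ∀ δ, 0 < (a δ).re) (δ : Bool)
    {l l' : Fin 4 → ℂ} {γ : ℂ} (hl : IsReflection a γ l l') : KernelIdentity a δ l l' γ := by
  intro z y hz hy h1 h2 h3 h4
  have main := coeff_four_term ha δ hl hz hy
  set s := step a δ with hs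
  have g1 : G a (z + y - γ + s) = R (a δ) (z + y - γ) * G a (z + y - γ - s) :=
    G_add_step ha δ (by have := h2.1; rwa [show z - s + y - γ = z + y - γ - s by ring] at this)
  have g2 : G a (z - y - γ + s) = R (a δ) (z - y - γ) * G a (z - y - γ - s) :=
    G_add_step ha δ (by have := h2.2.1; rwa [show z - s - y - γ = z - y - γ - s by ring] at this)
  have g3 : G a (-z + y - γ + s) = R (a δ) (-z + y - γ) * G a (-z + y - γ - s) :=
    G_add_step ha δ (by
      have := h1.2.2.1; rwa [show -(z + s) + y - γ = -z + y - γ - s by ring] at this)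
  have g4 : G a (-z - y - γ + s) = R (a δ) (-z - y - γ) * G a (-z - y - γ - s) :=
    G_add_step ha δ (by
      have := h1.2.2.2; rwa [show -(z + s) - y - γ = -z - y - γ - s by ring] at this)
  rw [show y + z - γ = z + y - γ by ring, show y - z - γ = -z + y - γ by ring,
    show -y + z - γ = z - y - γ by ring, show -y - z - γ = -z - y - γ by ring] at main
  simp only [act, K]
  rw [← hs, show z + s + y - γ = z + y - γ + s by ring, show z + s - y - γ = z - y - γ + s by ring,
    show -(z + s) + y - γ = -z + y - γ - s by ring, show -(z + s) - y - γ = -z - y - γ - s by ring,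
    show z - s + y - γ = z + y - γ - s by ring, show z - s - y - γ = z - y - γ - s by ring,
    show -(z - s) + y - γ = -z + y - γ + s by ring, show -(z - s) - y - γ = -z - y - γ + s by ring,
    show z + (y + s) - γ = z + y - γ + s by ring, show z - (y + s) - γ = z - y - γ - s by ring,
    show -z + (y + s) - γ = -z + y - γ + s by ring, show -z - (y + s) - γ = -z - y - γ - s by ring,
    show z + (y - s) - γ = z + y - γ - s by ring, show z - (y - s) - γ = z - y - γ + s by ring,
    show -z + (y - s) - γ = -z + y - γ - s by ring, show -z - (y - s) - γ = -z - y - γ + s by ring,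
    g1, g2, g3, g4]
  linear_combination (G a (z + y - γ - s) * G a (z - y - γ - s) * G a (-z + y - γ - s) *
    G a (-z - y - γ - s)) * main

theorem isReflection_phi1_of_even {a : Bool → ℂ} {l : Fin 4 → ℂ} {γ : ℂ} {m : ℤ}
    (h : 2 * γ = I * (a true + a false) + (∑ n, l n) + m) (hm : Even m) :
    IsReflection a γ l (phi1 l) := by
  refine ⟨⟨m, h⟩, fun n => ?_⟩
  obtain ⟨k, rfl⟩ := hm
  refine ⟨-k, ?_⟩
  rw [phi1]
  push_cast at h ⊢
  linear_combination -h / 2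

theorem isReflection_phi2_of_odd {a : Bool → ℂ} {l : Fin 4 → ℂ} {γ : ℂ} {m : ℤ}
    (h : 2 * γ = I * (a true + a false) + (∑ n, l n) + m) (hm : Odd m) :
    IsReflection a γ l (phi2 l) := by
  refine ⟨⟨m, h⟩, fun n => ?_⟩
  obtain ⟨k, rfl⟩ := hm
  refine ⟨-k, ?_⟩
  rw [phi2, phi1]
  push_cast at h ⊢
  linear_combination -h / 2

/-- Adding 1/2 to γ adds 1 to m, so the second kernel is the case of opposite parity. -/
theorem kernelIdentities {a : Bool → ℂ} (ha : ∀ δ, 0 < (a δ).re) (l : Fin 4 → ℂ) (γ : ℂ) (m : ℤ)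
    (h : 2 * γ = I * (a true + a false) + (∑ n, l n) + m) (δ : Bool) :
    (Even m → KernelIdentity a δ l (phi1 l) γ ∧ KernelIdentity a δ l (phi2 l) (γ + 1 / 2)) ∧
    (Odd m → KernelIdentity a δ l (phi2 l) γ ∧ KernelIdentity a δ l (phi1 l) (γ + 1 / 2)) := by
  have h' : 2 * (γ + 1 / 2) = I * (a true + a false) + (∑ n, l n) + (m + 1 : ℤ) := by
    push_cast; linear_combination h
  refine ⟨fun hm => ⟨?_, ?_⟩, fun hm => ⟨?_, ?_⟩⟩ <;> apply kernelIdentity_of_isReflection ha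
  · exact isReflection_phi1_of_even h hm
  · exact isReflection_phi2_of_odd h' hm.add_one
  · exact isReflection_phi2_of_odd h hm
  · exact isReflection_phi1_of_even h' hm.add_one

/-! ### Reversal in free algebras -/

theorem lift_apply_of_intertwines {J M N : Type*} [AddCommGroup M] [Module ℂ M] [AddCommGroup N]
    [Module ℂ N] {X : J → Module.End ℂ M} {Y : J → Module.End ℂ N} (f : M →ₗ[ℂ] N)
    (h : ∀ j m, f (X j m) = Y j (f m)) (p : FreeAlgebra ℂ J) :
    ∀ m, f (FreeAlgebra.lift ℂ X p m) = FreeAlgebra.lift ℂ Y p (f m) := by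
  induction p using FreeAlgebra.induction with
  | grade0 r => intro m; simp [Module.algebraMap_end_apply]
  | grade1 j => intro m; simp [h]
  | mul p q hp hq => intro m; simp [hp, hq]
  | add p q hp hq => intro m; simp [hp, hq]

theorem commute_lift {J A : Type*} [Ring A] [Algebra ℂ A] {X : J → A} {b : A}
    (h : ∀ j, Commute (X j) b) (p : FreeAlgebra ℂ J) : Commute (FreeAlgebra.lift ℂ X p) b := by
  induction p using FreeAlgebra.induction with
  | grade0 r => rw [AlgHom.commutes]; exact Algebra.commutes r b
  | grade1 j => simpa using h j
  | mul p q hp hq => rw [map_mul]; exact hp.mul_left hq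
  | add p q hp hq => rw [map_add]; exact hp.add_left hq

/-- On a product, p(X)q(X)k = p(X)q*(Y)k = q*(Y)p(X)k = q*(Y)p*(Y)k: moving each word past the other
side reverses the order. `star` on the free algebra reverses words and fixes letters and scalars, so
no complex conjugation enters. -/
theorem lift_apply_eq_lift_star_apply {J E : Type*} [AddCommGroup E] [Module ℂ E]
    {X Y : J → Module.End ℂ E} (hc : ∀ i j, Commute (X i) (Y j)) {k : E}
    (h : ∀ j, X j k = Y j k) (p : FreeAlgebra ℂ J) :
    FreeAlgebra.lift ℂ X p k = FreeAlgebra.lift ℂ Y (star p) k := by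
  have hc' : ∀ p q, Commute (FreeAlgebra.lift ℂ X p) (FreeAlgebra.lift ℂ Y q) := fun p q =>
    commute_lift (fun i => (commute_lift (fun j => (hc i j).symm) q).symm) p
  induction p using FreeAlgebra.induction with
  | grade0 r => simp [FreeAlgebra.star_algebraMap]
  | grade1 j => simp [FreeAlgebra.star_ι, h]
  | mul p q hp hq =>
    rw [star_mul, map_mul, map_mul, Module.End.mul_apply, Module.End.mul_apply, hq, ← hp]
    exact LinearMap.congr_fun (hc' p (star q)) k
  | add p q hp hq => simp [hp, hq]

/-- The hypothesis `h` says that reversing words and applying ψ to the letters preserves the kernel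
of the evaluation map, so this operation descends to the generated algebra. It need only be an
involution after evaluation, since ψ∘ψ fixes the operators and not necessarily the labels. -/
theorem exists_reversal {A J : Type*} [Ring A] [Algebra ℂ A] (g : J → A) (ψ : J → J)
    (hψ : ∀ j, g (ψ (ψ j)) = g j)
    (h : ∀ p, FreeAlgebra.lift ℂ g p = 0 → FreeAlgebra.lift ℂ (g ∘ ψ) (star p) = 0)
    {S : Subalgebra ℂ A} (hS : S = Algebra.adjoin ℂ (Set.range g)) :
    ∃ Φ : S ≃ₗ[ℂ] S, Φ 1 = 1 ∧ (∀ X Y, Φ (X * Y) = Φ Y * Φ X) ∧ (∀ X, Φ (Φ X) = X) ∧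
      ∀ (j : J) (X : S), (X : A) = g j → (Φ X : A) = g (ψ j) := by
  rw [Algebra.adjoin_range_eq_range_freeAlgebra_lift] at hS
  subst hS
  set f := FreeAlgebra.lift ℂ g with hf
  set θ : FreeAlgebra ℂ J → FreeAlgebra ℂ J :=
    fun p => FreeAlgebra.lift ℂ (FreeAlgebra.ι ℂ ∘ ψ) (star p) with hθ
  have hfψ : ∀ p, f (FreeAlgebra.lift ℂ (FreeAlgebra.ι ℂ ∘ ψ) p) =
      FreeAlgebra.lift ℂ (g ∘ ψ) p := by
    intro p
    have : f.comp (FreeAlgebra.lift ℂ (FreeAlgebra.ι ℂ ∘ ψ)) = FreeAlgebra.lift ℂ (g ∘ ψ) := by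
      ext j; simp [hf]
    exact AlgHom.congr_fun this p
  have hfθ : ∀ p, f (θ p) = FreeAlgebra.lift ℂ (g ∘ ψ) (star p) := fun p => hfψ _
  have hθadd : ∀ p q, θ (p + q) = θ p + θ q := fun p q => by simp [hθ]
  have hθmul : ∀ p q, θ (p * q) = θ q * θ p := fun p q => by simp [hθ]
  have hθc : ∀ r, θ (algebraMap ℂ _ r) = algebraMap ℂ _ r := fun r => by
    simp only [hθ, FreeAlgebra.star_algebraMap, AlgHom.commutes]
  have hθι : ∀ j, θ (FreeAlgebra.ι ℂ j) = FreeAlgebra.ι ℂ (ψ j) := fun j => by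
    simp [hθ, FreeAlgebra.star_ι]
  have hθθ : ∀ p, f (θ (θ p)) = f p := by
    intro p
    induction p using FreeAlgebra.induction with
    | grade0 r => rw [hθc, hθc]
    | grade1 j => rw [hθι, hθι]; simp [hf, hψ]
    | mul p q hp hq => rw [hθmul, hθmul, map_mul, map_mul, hp, hq]
    | add p q hp hq => rw [hθadd, hθadd, map_add, map_add, hp, hq]
  have hker : ∀ p q, f p = f q → f (θ p) = f (θ q) := by
    intro p q hpq
    have h0 := h (p - q) (by rw [map_sub, sub_eq_zero]; exact hpq)
    rw [← hfθ] at h0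
    have : θ p = θ (p - q) + θ q := by rw [← hθadd, sub_add_cancel]
    rw [this, map_add, h0, zero_add]
  -- Φ is defined through arbitrary preimages; `hker` makes the result independent of the choice.
  choose σ hσ using fun X : f.range => X.2
  have hσ' : ∀ X : f.range, f (σ X) = X := hσ
  set Φ : f.range → f.range := fun X => ⟨f (θ (σ X)), θ (σ X), rfl⟩ with hΦ
  have key : ∀ (p) (X : f.range), (X : A) = f p → (Φ X : A) = f (θ p) := by
    intro p X hX
    exact hker _ _ (by rw [hσ', hX])
  have hinv : Function.Involutive Φ := by
    intro X
    apply Subtype.ext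
    rw [key (θ (σ X)) (Φ X) rfl, hθθ, hσ']
  let Φl : f.range →ₗ[ℂ] f.range :=
    { toFun := Φ
      map_add' := fun X Y => by
        apply Subtype.ext
        rw [key (σ X + σ Y) (X + Y) (by simp [hσ']), hθadd, map_add]
        rfl
      map_smul' := fun r X => by
        apply Subtype.ext
        rw [key (algebraMap ℂ _ r * σ X) (r • X) (by simp [hσ', Algebra.smul_def]), hθmul, hθc,
          ← Algebra.commutes, ← Algebra.smul_def, map_smul]
        rfl }
  refine ⟨LinearEquiv.ofInvolutive Φl hinv, ?_, fun X Y => ?_, hinv, fun j X hX => ?_⟩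
  · apply Subtype.ext
    have := key 1 1 (by simp)
    have h1 : θ 1 = 1 := by simpa using hθc 1
    rw [h1, map_one] at this
    exact this
  · apply Subtype.ext
    have := key (σ X * σ Y) (X * Y) (by simp [hσ'])
    rw [hθmul, map_mul] at this
    exact this
  · have := key (FreeAlgebra.ι ℂ j) X (by simp [hf, hX])
    rw [hθι] at this
    exact (by simpa [hf] using this : (Φ X : A) = g (ψ j))

/-! ### Difference operators on a grid -/

theorem step_ne_zero {a : Bool → ℂ} (ha : ∀ δ, 0 < (a δ).re) (δ : Bool) : step a δ ≠ 0 := by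
  have : a (!δ) ≠ 0 := fun h => by simpa [h] using ha (!δ)
  simp [step, this]

/-- The operator `A_{R,δ}(l; z)` on functions on the grid `z₀ + ℤ step`. -/
def gridOp (a : Bool → ℂ) (δ : Bool) (z₀ : ℂ) (l : Fin 4 → ℂ) : Module.End ℂ (ℤ → ℂ) where
  toFun f i := coeff a δ l (z₀ + i * step a δ) * f (i + 1) +
    coeff a δ l (-(z₀ + i * step a δ)) * f (i - 1)
  map_add' f g := by ext i; simp only [Pi.add_apply]; ring
  map_smul' c f := by ext i; simp only [Pi.smul_apply, smul_eq_mul, RingHom.id_apply]; ring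

theorem gridOp_apply (a : Bool → ℂ) (δ : Bool) (z₀ : ℂ) (l : Fin 4 → ℂ) (f : ℤ → ℂ) (i : ℤ) :
    gridOp a δ z₀ l f i = coeff a δ l (z₀ + i * step a δ) * f (i + 1) +
      coeff a δ l (-(z₀ + i * step a δ)) * f (i - 1) := rfl

/-- Restriction of even functions to the grid `z₀ + ℤ step`. -/
def gridRestrict (a : Bool → ℂ) (δ : Bool) (z₀ : ℂ) : evenFunctions →ₗ[ℂ] (ℤ → ℂ) where
  toFun f i := (f : ℂ → ℂ) (z₀ + i * step a δ)
  map_add' _ _ := rfl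
  map_smul' _ _ := rfl

theorem gridRestrict_actLinear {a : Bool → ℂ} (ha : ∀ δ, 0 < (a δ).re) (δ : Bool) (z₀ : ℂ)
    (l : Fin 4 → ℂ) (f : evenFunctions) :
    gridRestrict a δ z₀ (actLinear a ha δ l f) = gridOp a δ z₀ l (gridRestrict a δ z₀ f) := by
  ext i
  simp only [gridRestrict, actLinear, act, gridOp, LinearMap.coe_mk, AddHom.coe_mk]
  push_cast
  ring_nf

/-- The span of the evaluation functionals on functions on `ℤ`. -/
def evalSpan : Submodule ℂ ((ℤ → ℂ) →ₗ[ℂ] ℂ) :=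
  Submodule.span ℂ (Set.range fun k : ℤ => LinearMap.proj k)

theorem proj_mem_evalSpan (k : ℤ) : (LinearMap.proj k : (ℤ → ℂ) →ₗ[ℂ] ℂ) ∈ evalSpan :=
  Submodule.subset_span ⟨k, rfl⟩

theorem exists_of_mem_evalSpan {e : (ℤ → ℂ) →ₗ[ℂ] ℂ} (he : e ∈ evalSpan) :
    ∃ c : ℤ →₀ ℂ, ∀ f, e f = ∑ k ∈ c.support, c k * f k := by
  obtain ⟨c, rfl⟩ := Finsupp.mem_span_range_iff_exists_finsupp.1 he
  refine ⟨c, fun f => ?_⟩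
  simp [Finsupp.sum, LinearMap.sum_apply]

/-- Each grid operator couples only neighbouring points, so finite combinations of evaluations stay
finite. -/
theorem comp_lift_gridOp_mem {J : Type*} (a : Bool → ℂ) (δ : Bool) (z₀ : ℂ) (u : J → Fin 4 → ℂ)
    (p : FreeAlgebra ℂ J) : ∀ e ∈ evalSpan,
      e.comp (FreeAlgebra.lift ℂ (fun j => gridOp a δ z₀ (u j)) p) ∈ evalSpan := by
  induction p using FreeAlgebra.induction with
  | grade0 r =>
    intro e he
    convert evalSpan.smul_mem r he using 1
    ext f; simp [Module.algebraMap_end_apply]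
  | grade1 j =>
    intro e he
    rw [FreeAlgebra.lift_ι_apply]
    induction he using Submodule.span_induction with
    | mem e he =>
      obtain ⟨k, rfl⟩ := he
      convert evalSpan.add_mem
        (evalSpan.smul_mem (coeff a δ (u j) (z₀ + k * step a δ)) (proj_mem_evalSpan (k + 1)))
        (evalSpan.smul_mem (coeff a δ (u j) (-(z₀ + k * step a δ))) (proj_mem_evalSpan (k - 1)))
        using 1
      exact LinearMap.ext fun f => rfl
    | zero => rw [LinearMap.zero_comp]; exact evalSpan.zero_mem
    | add e e' _ _ h h' => rw [LinearMap.add_comp]; exact evalSpan.add_mem h h'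
    | smul c e _ h => rw [LinearMap.smul_comp]; exact evalSpan.smul_mem c h
  | mul p q hp hq =>
    intro e he
    rw [map_mul]
    exact hq _ (hp e he)
  | add p q hp hq =>
    intro e he
    rw [map_add, LinearMap.comp_add]
    exact evalSpan.add_mem (hp e he) (hq e he)

/-- All coefficients are regular on the grid `z₀ + ℤ step`, which is disjoint from its negative. -/
def GridGeneric (a : Bool → ℂ) (δ : Bool) (z₀ : ℂ) : Prop :=
  (∀ i : ℤ, CoeffRegular a δ (z₀ + i * step a δ)) ∧ ∀ n : ℤ, 2 * z₀ + n * step a δ ≠ 0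

theorem countable_setOf_exists_int {P : ℤ → ℂ → Prop} (h : ∀ i, {z | P i z}.Countable) :
    {z | ∃ i, P i z}.Countable := by
  convert Set.countable_iUnion h using 1
  ext z
  simp

theorem countable_R_affine {a : ℂ} (ha : 0 < a.re) {c : ℂ} (hc : c ≠ 0) (d : ℂ) :
    {z | R a (c * z + d) = 0}.Countable :=
  countable_zeros_comp_mul_add (countable_R_zeros ha) hc d

theorem countable_not_gridGeneric {a : Bool → ℂ} (ha : ∀ δ, 0 < (a δ).re) (δ : Bool) :
    {z | ¬GridGeneric a δ z}.Countable := by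
  have h1 : {z | ∃ i : ℤ, R (a δ) (2 * z + (2 * (i * step a δ) - I * a δ / 2)) = 0}.Countable :=
    countable_setOf_exists_int fun i => countable_R_affine (ha δ) two_ne_zero _
  have h2 : {z | ∃ i : ℤ, R (a δ) (-2 * z + (-2 * (i * step a δ) - I * a δ / 2)) = 0}.Countable :=
    countable_setOf_exists_int fun i => countable_R_affine (ha δ) (neg_ne_zero.2 two_ne_zero) _
  have h3 : {z : ℂ | ∃ n : ℤ, 2 * z + n * step a δ = 0}.Countable :=
    countable_setOf_exists_int fun n => (Set.countable_singleton (-(n * step a δ) / 2)).mono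
      fun z hz => by
        have hz : 2 * z + n * step a δ = 0 := hz
        simp only [Set.mem_singleton_iff]
        linear_combination hz / 2
  refine ((h1.union h2).union h3).mono fun z hz => ?_
  by_contra hc
  simp only [Set.mem_union, Set.mem_ofPred_eq, not_or, not_exists] at hc
  refine hz ⟨fun i => ⟨?_, ?_⟩, hc.2⟩
  · convert hc.1.1 i using 2; ring
  · convert hc.1.2 i using 2; ring

theorem continuousAt_coeff {a : Bool → ℂ} (ha : ∀ δ, 0 < (a δ).re) (δ : Bool) (l : Fin 4 → ℂ)
    {z : ℂ} (hz : R (a δ) (2 * z - I * a δ / 2) ≠ 0) : ContinuousAt (coeff a δ l) z := by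
  have hR := (differentiable_R (ha δ)).continuous
  refine ContinuousAt.div (Continuous.continuousAt ?_) (Continuous.continuousAt ?_) hz
  · exact continuous_finsetProd _ fun n _ => hR.comp (by fun_prop)
  · exact hR.comp (by fun_prop)

/-- Even functions that are continuous at all points of a grid. -/
def continuousOnGrid (a : Bool → ℂ) (δ : Bool) (z₀ : ℂ) : Submodule ℂ evenFunctions where
  carrier := {f | ∀ i : ℤ, ContinuousAt (f : ℂ → ℂ) (z₀ + i * step a δ)}
  add_mem' hf hg i := (hf i).add (hg i)
  zero_mem' _ := continuousAt_const
  smul_mem' c _ hf i := (hf i).const_smul c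

theorem actLinear_mem_continuousOnGrid {a : Bool → ℂ} (ha : ∀ δ, 0 < (a δ).re) (δ : Bool) {z₀ : ℂ}
    (hz₀ : GridGeneric a δ z₀) (l : Fin 4 → ℂ) {f : evenFunctions}
    (hf : f ∈ continuousOnGrid a δ z₀) : actLinear a ha δ l f ∈ continuousOnGrid a δ z₀ := by
  intro i
  have hreg := hz₀.1 i
  set z := z₀ + i * step a δ with hz
  have h1 : ContinuousAt (fun w => coeff a δ l (-w)) z :=
    (continuousAt_coeff ha δ l hreg.2).comp continuousAt_neg
  have h2 : ContinuousAt (fun w => (f : ℂ → ℂ) (w + step a δ)) z := by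
    have := hf (i + 1)
    rw [show z₀ + ((i + 1 : ℤ) : ℂ) * step a δ = z + step a δ by rw [hz]; push_cast; ring] at this
    exact this.comp_of_eq (by fun_prop) rfl
  have h3 : ContinuousAt (fun w => (f : ℂ → ℂ) (w - step a δ)) z := by
    have := hf (i - 1)
    rw [show z₀ + ((i - 1 : ℤ) : ℂ) * step a δ = z - step a δ by rw [hz]; push_cast; ring] at this
    exact this.comp_of_eq (by fun_prop) rfl
  exact ((continuousAt_coeff ha δ l hreg.1).mul h2).add (h1.mul h3)

theorem lift_actLinear_mem_continuousOnGrid {J : Type*} {a : Bool → ℂ} (ha : ∀ δ, 0 < (a δ).re)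
    (δ : Bool) {z₀ : ℂ} (hz₀ : GridGeneric a δ z₀) (u : J → Fin 4 → ℂ) (p : FreeAlgebra ℂ J) :
    ∀ f ∈ continuousOnGrid a δ z₀,
      FreeAlgebra.lift ℂ (fun j => actLinear a ha δ (u j)) p f ∈ continuousOnGrid a δ z₀ := by
  induction p using FreeAlgebra.induction with
  | grade0 r => intro f hf; simpa [Module.algebraMap_end_apply] using Submodule.smul_mem _ r hf
  | grade1 j => intro f hf; simpa using actLinear_mem_continuousOnGrid ha δ hz₀ (u j) hf
  | mul p q hp hq => intro f hf; simpa using hp _ (hq f hf)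
  | add p q hp hq => intro f hf; simpa using Submodule.add_mem _ (hp f hf) (hq f hf)

theorem mk_lift_actLinear {J : Type*} {a : Bool → ℂ} (ha : ∀ δ, 0 < (a δ).re)
    (δ : Bool) (u : J → Fin 4 → ℂ) (p : FreeAlgebra ℂ J) (f : evenFunctions) :
    negligible.mkQ (FreeAlgebra.lift ℂ (fun j => actLinear a ha δ (u j)) p f) =
      FreeAlgebra.lift ℂ (fun j => generator a ha δ (u j)) p (negligible.mkQ f) :=
  lift_apply_of_intertwines negligible.mkQ (fun _ _ => rfl) p f

theorem eq_zero_of_mem_negligible {f : evenFunctions} (hf : f ∈ negligible) {z : ℂ}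
    (hc : ContinuousAt (f : ℂ → ℂ) z) : (f : ℂ → ℂ) z = 0 := by
  have h1 : Tendsto (f : ℂ → ℂ) (𝓝[≠] z) (𝓝 0) :=
    tendsto_const_nhds.congr' ((hf z).mono fun w hw => hw.symm)
  exact tendsto_nhds_unique (hc.tendsto.mono_left nhdsWithin_le_nhds) h1

/-- A linear combination of evaluations at the grid is determined by its values on even
polynomials. -/
theorem eq_zero_of_evalSpan {a : Bool → ℂ} (ha : ∀ δ, 0 < (a δ).re) (δ : Bool) {z₀ : ℂ}
    (hz₀ : GridGeneric a δ z₀) {e : (ℤ → ℂ) →ₗ[ℂ] ℂ} (he : e ∈ evalSpan)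
    (h : ∀ f ∈ continuousOnGrid a δ z₀, e (gridRestrict a δ z₀ f) = 0) : e = 0 := by
  obtain ⟨c, hc⟩ := exists_of_mem_evalSpan he
  suffices c = 0 by
    ext f; rw [hc, this]; simp
  ext k
  by_contra hk
  have hk : c k ≠ 0 := hk
  -- An even polynomial vanishing at every point of the support but one; it is nonzero at that point
  -- because the grid does not meet its negative.
  set F : ℂ → ℂ := fun z => ∏ j ∈ c.support.erase k, (z ^ 2 - (z₀ + j * step a δ) ^ 2) with hF
  have hFd : Differentiable ℂ F := by
    refine Differentiable.fun_finsetProd fun j _ => ?_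
    fun_prop
  have hFe : F ∈ evenFunctions :=
    ⟨fun z => (hFd.analyticAt z).meromorphicAt, fun z => by simp [hF]⟩
  have h0 := h ⟨F, hFe⟩ (fun i => hFd.continuous.continuousAt)
  rw [hc, Finset.sum_eq_single k] at h0
  · rcases mul_eq_zero.1 h0 with h0 | h0
    · exact hk h0
    · obtain ⟨j, hj, hj0⟩ := Finset.prod_eq_zero_iff.1 h0
      have h1 : (2 * z₀ + (k + j : ℤ) * step a δ) * ((k - j) * step a δ) = 0 := by
        push_cast; linear_combination hj0
      rcases mul_eq_zero.1 h1 with h1 | h1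
      · exact hz₀.2 _ h1
      · rcases mul_eq_zero.1 h1 with h1 | h1
        · exact (Finset.mem_erase.1 hj).1 (by exact_mod_cast (sub_eq_zero.1 h1).symm)
        · exact step_ne_zero ha δ h1
  · intro j hj hjk
    have : F (z₀ + j * step a δ) = 0 :=
      Finset.prod_eq_zero (Finset.mem_erase.2 ⟨hjk, hj⟩) (sub_self _)
    rw [show gridRestrict a δ z₀ ⟨F, hFe⟩ j = F (z₀ + j * step a δ) from rfl, this, mul_zero]
  · intro hk'
    exact absurd (Finsupp.mem_support_iff.2 hk) hk'

/-- A relation on 𝓜ₑ holds only off a discrete set. For functions continuous on the grid it holds at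
the grid points themselves, and such functions separate finite combinations of evaluations, so it
extends to arbitrary sequences. -/
theorem lift_gridOp_eq_zero {J : Type*} {a : Bool → ℂ} (ha : ∀ δ, 0 < (a δ).re)
    (δ : Bool) {z₀ : ℂ} (hz₀ : GridGeneric a δ z₀) (u : J → Fin 4 → ℂ) {p : FreeAlgebra ℂ J}
    (hp : FreeAlgebra.lift ℂ (fun j => generator a ha δ (u j)) p = 0) :
    FreeAlgebra.lift ℂ (fun j => gridOp a δ z₀ (u j)) p = 0 := by
  refine LinearMap.ext fun f => funext fun i => ?_
  have key : (LinearMap.proj i).comp (FreeAlgebra.lift ℂ (fun j => gridOp a δ z₀ (u j)) p) =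
      (0 : (ℤ → ℂ) →ₗ[ℂ] ℂ) := by
    refine eq_zero_of_evalSpan ha δ hz₀
      (comp_lift_gridOp_mem a δ z₀ u p _ (proj_mem_evalSpan i)) fun f hf => ?_
    have h1 := mk_lift_actLinear ha δ u p f
    rw [hp, LinearMap.zero_apply, Submodule.mkQ_apply, Submodule.Quotient.mk_eq_zero] at h1
    have h2 := eq_zero_of_mem_negligible h1
      (lift_actLinear_mem_continuousOnGrid ha δ hz₀ u p f hf i)
    have h3 := lift_apply_of_intertwines (gridRestrict a δ z₀)
      (fun j f => gridRestrict_actLinear ha δ z₀ (u j) f) p f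
    rw [LinearMap.comp_apply, ← h3]
    exact h2
  exact LinearMap.congr_fun key f

theorem lift_generator_eq_zero {J : Type*} {a : Bool → ℂ} (ha : ∀ δ, 0 < (a δ).re)
    (δ : Bool) (u : J → Fin 4 → ℂ) {p : FreeAlgebra ℂ J} {C : Set ℂ} (hC : C.Countable)
    (hp : ∀ z₀ ∉ C, FreeAlgebra.lift ℂ (fun j => gridOp a δ z₀ (u j)) p = 0) :
    FreeAlgebra.lift ℂ (fun j => generator a ha δ (u j)) p = 0 := by
  refine LinearMap.ext fun x => ?_
  obtain ⟨f, rfl⟩ := negligible.mkQ_surjective x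
  rw [← mk_lift_actLinear, LinearMap.zero_apply, Submodule.mkQ_apply,
    Submodule.Quotient.mk_eq_zero]
  set g := FreeAlgebra.lift ℂ (fun j => actLinear a ha δ (u j)) p f with hg
  have hgC : ∀ z₀ ∉ C, (g : ℂ → ℂ) z₀ = 0 := by
    intro z₀ hz₀
    have h3 := lift_apply_of_intertwines (gridRestrict a δ z₀)
      (fun j f => gridRestrict_actLinear ha δ z₀ (u j) f) p f
    rw [hp z₀ hz₀] at h3
    have := congrFun h3 0
    simpa [gridRestrict] using this
  intro z
  -- A meromorphic function is either zero or nowhere zero on a punctured neighbourhood; the latter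
  -- is impossible, since g vanishes off a countable set.
  refine (g.2.1 z).eventually_eq_zero_or_eventually_ne_zero.resolve_right fun hne => ?_
  rw [eventually_nhdsWithin_iff, eventually_nhds_iff] at hne
  obtain ⟨U, hU, hUo, hzU⟩ := hne
  obtain ⟨w, hw1, hw2⟩ := (dense_compl_of_countable (hC.insert z)).inter_open_nonempty U hUo
    ⟨z, hzU⟩
  rw [Set.mem_compl_iff, Set.mem_insert_iff, not_or] at hw2
  exact hU w hw1 hw2.1 (hgC w hw2.2)

/-! ### Transport of relations through kernels. -/

/-- Every relation between the operators `A_{R,δ}(u j; z)` yields the reversed relation between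
the operators `A_{R,δ}(v j; z)`. -/
def Reverses {J : Type*} (a : Bool → ℂ) (ha : ∀ δ, 0 < (a δ).re) (δ : Bool)
    (u v : J → Fin 4 → ℂ) : Prop :=
  ∀ p, FreeAlgebra.lift ℂ (fun j => generator a ha δ (u j)) p = 0 →
    FreeAlgebra.lift ℂ (fun j => generator a ha δ (v j)) (star p) = 0

theorem Reverses.trans_trans {J : Type*} {a : Bool → ℂ} {ha : ∀ δ, 0 < (a δ).re} {δ : Bool}
    {u v w x : J → Fin 4 → ℂ} (h₁ : Reverses a ha δ u v) (h₂ : Reverses a ha δ v w)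
    (h₃ : Reverses a ha δ w x) : Reverses a ha δ u x := by
  intro p hp
  simpa using h₃ _ (h₂ _ (h₁ p hp))

/-- `k` intertwines `A_{R,δ}(l; z)` on the grid at `z₀` with `A_{R,δ}(l'; y)` on the grid at
`y₀`. -/
def IsGridKernel (a : Bool → ℂ) (δ : Bool) (z₀ y₀ : ℂ) (l l' : Fin 4 → ℂ) (k : ℤ → ℤ → ℂ) : Prop :=
  ∀ i j, gridOp a δ z₀ l (fun i => k i j) i = gridOp a δ y₀ l' (k i) j

/-- The functional e to be killed is evaluation of the reversed relation at one grid point. It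
annihilates every row of every kernel, because the original relation, acting on the first index, is
zero. -/
theorem reverses_of_gridKernels {J : Type*} {a : Bool → ℂ} (ha : ∀ δ, 0 < (a δ).re)
    (δ : Bool) {u v : J → Fin 4 → ℂ} {C : Set ℂ} (hC : C.Countable)
    (h : ∀ y₀ ∉ C, ∀ e ∈ evalSpan, (∀ z₀ k, GridGeneric a δ z₀ →
      (∀ j, IsGridKernel a δ z₀ y₀ (u j) (v j) k) → ∀ i, e (k i) = 0) → e = 0) :
    Reverses a ha δ u v := by
  intro p hp
  refine lift_generator_eq_zero ha δ v hC fun y₀ hy₀ => ?_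
  refine LinearMap.ext fun f => funext fun m => ?_
  have key : (LinearMap.proj m).comp
      (FreeAlgebra.lift ℂ (fun j => gridOp a δ y₀ (v j)) (star p)) = (0 : (ℤ → ℂ) →ₗ[ℂ] ℂ) := by
    refine h y₀ hy₀ _ (comp_lift_gridOp_mem a δ y₀ v _ _ (proj_mem_evalSpan m)) ?_
    intro z₀ k hz₀ hk i
    let X : J → Module.End ℂ (ℤ → ℤ → ℂ) := fun j =>
      { toFun := fun k i m => gridOp a δ z₀ (u j) (fun i => k i m) i
        map_add' := fun k k' => by ext i m; simp only [gridOp_apply, Pi.add_apply]; ring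
        map_smul' := fun c k => by
          ext i m
          simp only [gridOp_apply, Pi.smul_apply, smul_eq_mul, RingHom.id_apply]; ring }
    let Y : J → Module.End ℂ (ℤ → ℤ → ℂ) := fun j =>
      { toFun := fun k i => gridOp a δ y₀ (v j) (k i)
        map_add' := fun k k' => by ext i m; simp only [map_add, Pi.add_apply]
        map_smul' := fun c k => by
          ext i m; simp only [map_smul, Pi.smul_apply, RingHom.id_apply] }
    have hc : ∀ i j, Commute (X i) (Y j) := by
      intro i j
      refine LinearMap.ext fun k => ?_
      ext m n
      simp only [X, Y, Module.End.mul_apply, LinearMap.coe_mk, AddHom.coe_mk, gridOp_apply]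
      ring
    have h1 := lift_apply_eq_lift_star_apply hc (k := k)
      (fun j => by ext i m; exact hk j i m) p
    have h2 := lift_apply_of_intertwines (X := Y) (Y := fun j => gridOp a δ y₀ (v j))
      (LinearMap.proj i) (fun _ _ => rfl) (star p) k
    let ev : (ℤ → ℤ → ℂ) →ₗ[ℂ] (ℤ → ℂ) :=
      { toFun := fun k i => k i m
        map_add' := fun _ _ => rfl
        map_smul' := fun _ _ => rfl }
    have h3 := lift_apply_of_intertwines (X := X) (Y := fun j => gridOp a δ z₀ (u j))
      ev (fun _ _ => rfl) p k
    rw [lift_gridOp_eq_zero ha δ hz₀ u hp, LinearMap.zero_apply] at h3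
    rw [LinearMap.comp_apply]
    simp only [LinearMap.proj_apply] at h2 ⊢
    rw [← h2, ← h1]
    exact congrFun h3 i
  exact LinearMap.congr_fun key f

/-- A functional in the span of the evaluations that kills a triangular kernel vanishes. -/
theorem eq_zero_of_triangular {e : (ℤ → ℂ) →ₗ[ℂ] ℂ} (he : e ∈ evalSpan) {k : ℤ → ℤ → ℂ}
    (h : ∀ i, e (k i) = 0) (hd : ∀ i, k i i ≠ 0) (ht : ∀ i j, i < j → k i j = 0) : e = 0 := by
  obtain ⟨c, hc⟩ := exists_of_mem_evalSpan he
  suffices c = 0 by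
    ext f; rw [hc, this]; simp
  by_contra hne
  have hs : c.support.Nonempty := Finsupp.support_nonempty_iff.2 hne
  have h0 := h (c.support.min' hs)
  rw [hc, Finset.sum_eq_single (c.support.min' hs)] at h0
  · exact (Finsupp.mem_support_iff.1 (c.support.min'_mem hs))
      ((mul_eq_zero.1 h0).resolve_right (hd _))
  · intro j hj hne
    rw [ht _ _ (lt_of_le_of_ne (c.support.min'_le j hj) (Ne.symm hne)), mul_zero]
  · intro hn; exact absurd (c.support.min'_mem hs) hn

/-- Supplies nowhere vanishing grid substitutes for G: on a grid only first-order ratios matter. -/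
theorem exists_recursion {r : ℤ → ℂ} (hr : ∀ m, r m ≠ 0) :
    ∃ H : ℤ → ℂ, (∀ m, H m ≠ 0) ∧ ∀ m, H (m + 1) = r m * H m := by
  let H : ℤ → ℂ := fun m => match m with
    | Int.ofNat n => ∏ i ∈ Finset.range n, r i
    | Int.negSucc n => (∏ i ∈ Finset.range (n + 1), r (Int.negSucc i))⁻¹
  refine ⟨H, fun m => ?_, fun m => ?_⟩
  · cases m with
    | ofNat n => exact Finset.prod_ne_zero_iff.2 fun i _ => hr i
    | negSucc n => exact inv_ne_zero (Finset.prod_ne_zero_iff.2 fun i _ => hr _)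
  · rcases m with n | n
    · change ∏ i ∈ Finset.range (n + 1), r i = r n * ∏ i ∈ Finset.range n, r i
      rw [Finset.prod_range_succ, mul_comm]
    · rcases n with _ | n
      · change ∏ i ∈ Finset.range 0, r i = r (Int.negSucc 0) *
          (∏ i ∈ Finset.range 1, r (Int.negSucc i))⁻¹
        simp [hr]
      · change (∏ i ∈ Finset.range (n + 1), r (Int.negSucc i))⁻¹ = r (Int.negSucc (n + 1)) *
          (∏ i ∈ Finset.range (n + 2), r (Int.negSucc i))⁻¹
        rw [Finset.prod_range_succ _ (n + 1), mul_inv, mul_comm, mul_assoc, inv_mul_cancel₀ (hr _),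
          mul_one]

/-! ### Transposition -/

/-- The diagonal kernel W expresses that A(-l) is the transpose of A(l) for the weight W. The
numerators of the two coefficients agree because R is even and neighbouring points differ by s; W
corrects the denominators, which do not depend on l. -/
theorem reverses_neg {J : Type*} {a : Bool → ℂ} (ha : ∀ δ, 0 < (a δ).re) (δ : Bool)
    (u : J → Fin 4 → ℂ) : Reverses a ha δ u (fun j => -u j) := by
  refine reverses_of_gridKernels ha δ (countable_not_gridGeneric ha δ) fun y₀ hy₀ e he h => ?_
  have hy : GridGeneric a δ y₀ := not_not.1 hy₀
  set s := step a δ with hs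
  set T : ℂ → ℂ := fun z => R (a δ) (2 * z - I * a δ / 2) with hT
  have hT1 : ∀ i : ℤ, T (y₀ + i * s) ≠ 0 := fun i => (hy.1 i).1
  have hT2 : ∀ i : ℤ, T (-(y₀ + i * s)) ≠ 0 := fun i => (hy.1 i).2
  obtain ⟨W, hW0, hW⟩ := exists_recursion
    (r := fun m => T (y₀ + m * s) / T (-(y₀ + (m + 1 : ℤ) * s)))
    fun m => div_ne_zero (hT1 m) (hT2 _)
  have hW' : ∀ m, W (m + 1) * T (-(y₀ + (m + 1 : ℤ) * s)) = T (y₀ + m * s) * W m := fun m => by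
    have := hT2 (m + 1)
    rw [hW, mul_right_comm, div_mul_cancel₀ _ this]
  have hN : ∀ (l : Fin 4 → ℂ) (m : ℤ), ∏ n, R (a δ) (y₀ + m * s + l n + I * a (!δ) / 4) =
      ∏ n, R (a δ) (-(y₀ + (m + 1 : ℤ) * s) + (-l) n + I * a (!δ) / 4) := by
    intro l m
    refine Finset.prod_congr rfl fun n _ => ?_
    rw [← R_neg]
    congr 1
    rw [hs, step, Pi.neg_apply]; push_cast; ring
  have hA : ∀ (l : Fin 4 → ℂ) (m : ℤ), coeff a δ l (y₀ + m * s) * W (m + 1) =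
      coeff a δ (-l) (-(y₀ + (m + 1 : ℤ) * s)) * W m := by
    intro l m
    have e1 : coeff a δ l (y₀ + m * s) =
      (∏ n, R (a δ) (y₀ + m * s + l n + I * a (!δ) / 4)) / T (y₀ + m * s) := rfl
    have e2 : coeff a δ (-l) (-(y₀ + (m + 1 : ℤ) * s)) =
      (∏ n, R (a δ) (-(y₀ + (m + 1 : ℤ) * s) + (-l) n + I * a (!δ) / 4)) /
        T (-(y₀ + (m + 1 : ℤ) * s)) := rfl
    rw [e1, e2, ← hN, div_mul_eq_mul_div, div_mul_eq_mul_div, div_eq_div_iff (hT1 m) (hT2 _),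
      mul_assoc, hW']
    ring
  have hB : ∀ (l : Fin 4 → ℂ) (m : ℤ), coeff a δ l (-(y₀ + (m + 1 : ℤ) * s)) * W m =
      coeff a δ (-l) (y₀ + m * s) * W (m + 1) := by
    intro l m
    rw [hA, neg_neg]
  refine eq_zero_of_triangular he (k := fun i j => if i = j then W i else 0)
    (h y₀ _ hy fun j i m => ?_) (fun i => by simp [hW0]) (fun i j hij => by simp [hij.ne])
  simp only [gridOp_apply]
  rw [← hs]
  by_cases h1 : m = i + 1
  · subst h1
    simp only [if_true, add_sub_cancel_right]
    rw [if_neg (by omega), if_neg (by omega), hA]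
    ring
  · by_cases h2 : i = m + 1
    · subst h2
      simp only [if_true, add_sub_cancel_right]
      rw [if_neg (by omega), if_neg (by omega), hB]
      ring
    · rw [if_neg (by omega), if_neg (by omega), if_neg (by omega), if_neg (by omega)]
      ring

/-! ### Kernels that are products of functions of the sum and the difference -/

/-- The kernel `D((i - j)/2) H((i + j)/2)`, supported where `i - j` is even. -/
def productKernel (D H : ℤ → ℂ) (i j : ℤ) : ℂ :=
  if Even (i - j) then D ((i - j) / 2) * H ((i + j) / 2) else 0

theorem productKernel_even (D H : ℤ → ℂ) (t j : ℤ) :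
    productKernel D H (j + 2 * t) j = D t * H (j + t) := by
  rw [productKernel, if_pos ⟨t, by ring⟩]
  congr 2
  · omega
  · omega

theorem productKernel_odd (D H : ℤ → ℂ) {i j : ℤ} (h : ¬Even (i - j)) :
    productKernel D H i j = 0 := if_neg h

theorem isGridKernel_productKernel {a : Bool → ℂ} {δ : Bool} {z₀ y₀ : ℂ} {l l' : Fin 4 → ℂ}
    {D H : ℤ → ℂ} (h : ∀ (t M : ℤ) (z y : ℂ), z = z₀ + (t + M - 1 : ℤ) * step a δ →
      y = y₀ + (M - t : ℤ) * step a δ →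
      coeff a δ l z * (D t * H M) + coeff a δ l (-z) * (D (t - 1) * H (M - 1)) =
        coeff a δ l' y * (D (t - 1) * H M) + coeff a δ l' (-y) * (D t * H (M - 1))) :
    IsGridKernel a δ z₀ y₀ l l' (productKernel D H) := by
  intro i j
  rw [gridOp_apply, gridOp_apply]
  by_cases he : Even (i - j)
  -- Each side moves one index by one, so for even i - j all four entries vanish by parity.
  · rw [productKernel_odd, productKernel_odd, productKernel_odd, productKernel_odd]
    · ring
    all_goals
      rw [Int.even_iff] at he ⊢
      omega
  · obtain ⟨t, ht⟩ : ∃ t, i = j + 2 * t - 1 := by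
      rw [Int.not_even_iff_odd] at he
      obtain ⟨t, ht⟩ := he
      exact ⟨t + 1, by omega⟩
    have h1 : productKernel D H (i + 1) j = D t * H (j + t) := by
      rw [← productKernel_even, ht]; congr 1; ring
    have h2 : productKernel D H (i - 1) j = D (t - 1) * H (j + t - 1) := by
      rw [add_sub_assoc, ← productKernel_even, ht]; congr 1; ring
    have h3 : productKernel D H i (j + 1) = D (t - 1) * H (j + t) := by
      rw [show j + t = j + 1 + (t - 1) by ring, ← productKernel_even, ht]; congr 1; ring
    have h4 : productKernel D H i (j - 1) = D t * H (j + t - 1) := by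
      rw [show j + t - 1 = j - 1 + t by ring, ← productKernel_even, ht]; congr 1; ring
    rw [h1, h2, h3, h4]
    refine h t (j + t) _ _ ?_ ?_
    · rw [ht]; congr 3; ring
    · congr 3; ring

/-- D and H replace the (z - y)- and (z + y)-parts of K; clearing their ratios returns
`coeff_four_term`. -/
theorem four_term_of_ratio {a : Bool → ℂ} (ha : ∀ δ, 0 < (a δ).re) (δ : Bool) {l l' : Fin 4 → ℂ}
    {γ : ℂ} (hl : IsReflection a γ l l') {z y u v : ℂ} (hz : CoeffRegular a δ z)
    (hy : CoeffRegular a δ y) (hu : u = z + y) (hv : v = z - y) {D₁ D₀ H₁ H₀ : ℂ}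
    (hu0 : R (a δ) (u + γ) ≠ 0) (hv0 : R (a δ) (v + γ) ≠ 0)
    (hH : H₁ = R (a δ) (u - γ) / R (a δ) (u + γ) * H₀)
    (hD : D₁ = R (a δ) (v - γ) / R (a δ) (v + γ) * D₀) :
    coeff a δ l z * (D₁ * H₁) + coeff a δ l (-z) * (D₀ * H₀) =
      coeff a δ l' y * (D₀ * H₁) + coeff a δ l' (-y) * (D₁ * H₀) := by
  have main := coeff_four_term ha δ hl hz hy
  rw [show -z + y - γ = -(v + γ) by rw [hv]; ring, show -z - y - γ = -(u + γ) by rw [hu]; ring,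
    show z + y - γ = u - γ by rw [hu], show z - y - γ = v - γ by rw [hv],
    show y + z - γ = u - γ by rw [hu]; ring, show y - z - γ = -(v + γ) by rw [hv]; ring,
    show -y + z - γ = v - γ by rw [hv]; ring, show -y - z - γ = -(u + γ) by rw [hu]; ring,
    R_neg, R_neg] at main
  rw [hH, hD]
  generalize R (a δ) (u - γ) = p at *
  generalize R (a δ) (u + γ) = p' at *
  generalize R (a δ) (v - γ) = r at *
  generalize R (a δ) (v + γ) = r' at *
  field_simp
  linear_combination (D₀ * H₀) * main

/-- At the lower end of the support of D only D₁ survives. Here R(u ∓ γ) are exactly the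
denominators of the two coefficients, and the numerators agree factor by factor. -/
theorem two_term_lower {a : Bool → ℂ} {δ : Bool} {l l' : Fin 4 → ℂ}
    {γ : ℂ} (hl : IsReflection a γ l l') {z y u : ℂ} (hz : CoeffRegular a δ z)
    (hy : CoeffRegular a δ y) (hu : u = z + y) (hv : z - y = -γ + I * a δ / 2) :
    coeff a δ l z * R (a δ) (u - γ) = coeff a δ l' (-y) * R (a δ) (u + γ) := by
  have e1 : R (a δ) (u - γ) = R (a δ) (2 * z - I * a δ / 2) := by
    congr 1; rw [hu]; linear_combination -hv
  have e2 : R (a δ) (u + γ) = R (a δ) (2 * (-y) - I * a δ / 2) := by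
    rw [← R_neg]; congr 1; rw [hu]; linear_combination -hv
  rw [e1, e2, coeff, coeff, div_mul_cancel₀ _ hz.1, div_mul_cancel₀ _ hy.2]
  refine Finset.prod_congr rfl fun n _ => ?_
  obtain ⟨k, hk⟩ := hl.2 n
  rw [← R_neg, ← R_add_int _ _ k]
  congr 1
  rw [hk, add_not a δ]
  linear_combination -hv

/-- The counterpart at the upper end, where only D₀ survives. The end is reached only modulo the
period lattice, so quasiperiod multipliers appear. -/
theorem two_term_upper {a : Bool → ℂ} (ha : ∀ δ, 0 < (a δ).re) {δ : Bool} {l l' : Fin 4 → ℂ}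
    {γ : ℂ} (hl : IsReflection a γ l l') {z y u : ℂ} (hz : CoeffRegular a δ z)
    (hy : CoeffRegular a δ y) (hu : u = z + y) {m n : ℤ}
    (hv : z - y = γ - I * a δ / 2 + (m + n * (I * a δ))) :
    coeff a δ l (-z) * R (a δ) (u + γ) = coeff a δ l' y * R (a δ) (u - γ) := by
  obtain ⟨z', rfl⟩ : ∃ z', z = z' + (m + n * (I * a δ)) := ⟨z - (m + n * (I * a δ)), by ring⟩
  have hv' : z' - y = γ - I * a δ / 2 := by linear_combination hv
  have e1 : R (a δ) (u - γ) = mult (a δ) n (2 * y - I * a δ / 2) *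
      R (a δ) (2 * y - I * a δ / 2) := by
    rw [← R_add_lattice (ha δ) m]; congr 1; rw [hu]; linear_combination hv'
  have e2 : R (a δ) (u + γ) = mult (a δ) n (2 * z' + I * a δ / 2) *
      R (a δ) (2 * z' + I * a δ / 2) := by
    rw [← R_add_lattice (ha δ) m]; congr 1; rw [hu]; linear_combination -hv'
  have e3 : R (a δ) (2 * (-(z' + (m + n * (I * a δ)))) - I * a δ / 2) =
      mult (a δ) (2 * n) (2 * z' + I * a δ / 2) * R (a δ) (2 * z' + I * a δ / 2) := by
    rw [← R_add_lattice (ha δ) (2 * m), ← R_neg]; congr 1; push_cast; ring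
  have hz2 := hz.2
  rw [e3] at hz2
  have hz3 := right_ne_zero_of_mul hz2
  have hm := left_ne_zero_of_mul hz2
  have e4 : ∏ j, R (a δ) (-(z' + (m + n * (I * a δ))) + l j + I * a (!δ) / 4) =
      (∏ j, mult (a δ) n (z' - l j - I * a (!δ) / 4)) *
        ∏ j, R (a δ) (y + l' j + I * a (!δ) / 4) := by
    rw [← Finset.prod_mul_distrib]
    refine Finset.prod_congr rfl fun j _ => ?_
    obtain ⟨k, hk⟩ := hl.2 j
    have : R (a δ) (y + l' j + I * a (!δ) / 4) = R (a δ) (z' - l j - I * a (!δ) / 4) := by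
      rw [← R_add_int _ (z' - _ - _) k]
      congr 1
      rw [hk, add_not a δ]
      linear_combination -hv'
    rw [this, ← R_add_lattice (ha δ) m, ← R_neg]
    congr 1
    ring
  -- The multipliers cancel because ∑ l_j is tied to γ modulo integers.
  have e5 : (∏ j, mult (a δ) n (z' - l j - I * a (!δ) / 4)) * mult (a δ) n (2 * z' + I * a δ / 2) =
      mult (a δ) (2 * n) (2 * z' + I * a δ / 2) * mult (a δ) n (2 * y - I * a δ / 2) := by
    obtain ⟨k, hk⟩ := hl.1
    rw [add_not a δ, Fin.sum_univ_four] at hk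
    rw [Fin.prod_univ_four]
    simp only [mult]
    rw [← exp_add, ← exp_add, ← exp_add, ← exp_add, ← exp_add, exp_eq_exp_iff_exists_int]
    refine ⟨n * (1 - k), ?_⟩
    push_cast
    linear_combination (-(2 * Real.pi * I * n : ℂ)) * hk - (4 * Real.pi * I * n : ℂ) * hv'
  rw [coeff, e3, e4, e2, coeff, e1]
  have hy1 := hy.1
  generalize R (a δ) (2 * z' + I * a δ / 2) = r at *
  generalize R (a δ) (2 * y - I * a δ / 2) = r' at *
  generalize mult (a δ) (2 * n) (2 * z' + I * a δ / 2) = p at *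
  generalize mult (a δ) n (2 * z' + I * a δ / 2) = p' at *
  generalize mult (a δ) n (2 * y - I * a δ / 2) = p'' at *
  generalize ∏ j, mult (a δ) n (z' - l j - I * a (!δ) / 4) = q at *
  generalize ∏ j, R (a δ) (y + l' j + I * a (!δ) / 4) = t at *
  field_simp
  linear_combination t * e5

/-- The ratio defining D has a zero numerator at t = k + 1 by `hγ` and a zero denominator at t = 0,
so D can be cut off to 0 ≤ t ≤ k; `hk` keeps the ratios in between finite. Since D(0) = 1 and D
vanishes for t < 0, the kernel is triangular with nonzero diagonal. -/
theorem reverses_of_finite_kernel {J : Type*} {a : Bool → ℂ} (ha : ∀ δ, 0 < (a δ).re) (δ : Bool)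
    {u v : J → Fin 4 → ℂ} {γ : ℂ} (huv : ∀ j, IsReflection a γ (u j) (v j)) {k : ℕ} {m n : ℤ}
    (hγ : 2 * γ = (k + 1) * (2 * step a δ) + (m + n * (I * a δ)))
    (hk : ∀ t : ℕ, 1 ≤ t → t ≤ k → R (a δ) (I * a δ / 2 + t * (2 * step a δ)) ≠ 0) :
    Reverses a ha δ u v := by
  set s := step a δ with hs
  -- With z₀ = y₀ + w one has z - y = -γ + ia_δ/2 + 2ts, so that t = 0 falls on the zero of R(z - y
  -- + γ).
  set w := s - γ + I * a δ / 2 with hw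
  have c1 := countable_not_gridGeneric ha δ
  have c2 : {y | ¬GridGeneric a δ (y + w)}.Countable :=
    c1.preimage (f := fun y => y + w) (add_left_injective w)
  have c3 : {y | ∃ M : ℤ, R (a δ) (2 * y + (w + (2 * M - 1) * s - γ)) = 0}.Countable :=
    countable_setOf_exists_int fun M => countable_R_affine (ha δ) two_ne_zero _
  have c4 : {y | ∃ M : ℤ, R (a δ) (2 * y + (w + (2 * M - 1) * s + γ)) = 0}.Countable :=
    countable_setOf_exists_int fun M => countable_R_affine (ha δ) two_ne_zero _
  refine reverses_of_gridKernels ha δ (((c1.union c2).union c3).union c4) fun y₀ hy₀ e he h => ?_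
  simp only [Set.mem_union, Set.mem_ofPred_eq, not_or, not_not, not_exists] at hy₀
  obtain ⟨⟨⟨hy, hz⟩, h3⟩, h4⟩ := hy₀
  obtain ⟨H, hH0, hH⟩ := exists_recursion
    (r := fun M => R (a δ) (2 * y₀ + (w + (2 * (M + 1 : ℤ) - 1) * s - γ)) /
      R (a δ) (2 * y₀ + (w + (2 * (M + 1 : ℤ) - 1) * s + γ)))
    fun M => div_ne_zero (h3 _) (h4 _)
  have hH' : ∀ M, H M = R (a δ) (2 * y₀ + (w + (2 * M - 1) * s - γ)) /
      R (a δ) (2 * y₀ + (w + (2 * M - 1) * s + γ)) * H (M - 1) := by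
    intro M
    have := hH (M - 1)
    simpa only [sub_add_cancel] using this
  set E : ℕ → ℂ := fun t => ∏ i ∈ Finset.range t,
    R (a δ) (I * a δ / 2 + (i + 1 : ℕ) * (2 * s) - 2 * γ) /
      R (a δ) (I * a δ / 2 + (i + 1 : ℕ) * (2 * s)) with hE
  set D : ℤ → ℂ := fun t => if 0 ≤ t ∧ t ≤ k then E t.toNat else 0 with hD
  have hD0 : D 0 = 1 := by simp [hD, hE]
  have hDneg : ∀ t, t < 0 → D t = 0 := fun t ht => if_neg (by omega)
  have hDbig : ∀ t : ℤ, k < t → D t = 0 := fun t ht => if_neg (by omega)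
  have hDstep : ∀ t : ℕ, t + 1 ≤ k → D ((t + 1 : ℕ) : ℤ) =
      R (a δ) (I * a δ / 2 + (t + 1 : ℕ) * (2 * s) - 2 * γ) /
        R (a δ) (I * a δ / 2 + (t + 1 : ℕ) * (2 * s)) * D t := by
    intro t ht
    have e1 : D ((t + 1 : ℕ) : ℤ) = E (t + 1) := if_pos ⟨by omega, by omega⟩
    have e2 : D (t : ℤ) = E t := if_pos ⟨by omega, by omega⟩
    rw [e1, e2, hE]
    simp only
    rw [Finset.prod_range_succ, mul_comm]
  refine eq_zero_of_triangular he (k := productKernel D H) (h (y₀ + w) _ hz fun j => ?_)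
    (fun i => ?_) (fun i j hij => ?_)
  · refine isGridKernel_productKernel fun t M z y hzt hyt => ?_
    rw [← hs] at hzt hyt
    have hzr : CoeffRegular a δ z := by rw [hzt]; exact hz.1 _
    have hyr : CoeffRegular a δ y := by rw [hyt]; exact hy.1 _
    have hu : 2 * y₀ + (w + (2 * M - 1) * s) = z + y := by rw [hzt, hyt]; push_cast; ring
    have hv : z - y = -γ + I * a δ / 2 + t * (2 * s) := by
      rw [hzt, hyt, hw]; push_cast; ring
    have hHM := hH' M
    have h3M := h3 M
    have h4M := h4 M
    have hu₁ : 2 * y₀ + (w + (2 * M - 1) * s - γ) = z + y - γ := by linear_combination hu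
    have hu₂ : 2 * y₀ + (w + (2 * M - 1) * s + γ) = z + y + γ := by linear_combination hu
    rw [hu₁] at h3M hHM
    rw [hu₂] at h4M hHM
    rcases lt_or_ge t 0 with ht | ht
    · rw [hDneg t ht, hDneg (t - 1) (by omega)]; ring
    rcases lt_or_ge (k + 1 : ℤ) t with ht' | ht'
    · rw [hDbig t (by omega), hDbig (t - 1) (by omega)]; ring
    rcases eq_or_lt_of_le ht with rfl | ht1
    · have h2 := two_term_lower (huv j) hzr hyr rfl (by simpa using hv)
      rw [hDneg (0 - 1) (by omega), hHM]
      generalize R (a δ) (z + y - γ) = p at *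
      generalize R (a δ) (z + y + γ) = p' at *
      field_simp
      linear_combination (D 0 * H (M - 1)) * h2
    rcases eq_or_lt_of_le ht' with rfl | ht2
    · have h2 := two_term_upper ha (m := -m) (n := 1 - n) (huv j) hzr hyr rfl (by
        rw [hv]; push_cast; linear_combination -hγ)
      rw [hDbig (k + 1) (by omega), hHM]
      generalize R (a δ) (z + y - γ) = p at *
      generalize R (a δ) (z + y + γ) = p' at *
      field_simp
      linear_combination (D (k + 1 - 1) * H (M - 1)) * h2
    · obtain ⟨r, rfl⟩ : ∃ r : ℕ, t = (r + 1 : ℕ) := ⟨(t - 1).toNat, by omega⟩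
      have h2 := hDstep r (by omega)
      have h5 := hk (r + 1) (by omega) (by omega)
      have e1 : I * a δ / 2 + ((r + 1 : ℕ) : ℂ) * (2 * s) = z - y + γ := by
        rw [hv]; push_cast; ring
      rw [e1] at h2 h5
      rw [show z - y + γ - 2 * γ = z - y - γ by ring] at h2
      rw [show ((r + 1 : ℕ) : ℤ) - 1 = r by push_cast; ring]
      exact four_term_of_ratio ha δ (huv j) hzr hyr rfl rfl h4M h5 hHM h2
  · have := productKernel_even D H 0 i
    rw [mul_zero, add_zero, hD0, one_mul] at this
    rw [this]
    exact hH0 i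
  · by_cases hp : Even (i - j)
    · rw [productKernel, if_pos hp, hDneg _ (by omega), zero_mul]
    · exact productKernel_odd D H hp

/-- Take the row at the lowest point i of the support of e and divide it by its diagonal entry. As
z₀ tends to x₁, all entries to the right of i tend to 0, which leaves the coefficient c(i) and
forces it to vanish. -/
theorem reverses_of_nonresonant {J : Type*} {a : Bool → ℂ} (ha : ∀ δ, 0 < (a δ).re) (δ : Bool)
    {u v : J → Fin 4 → ℂ} {γ : ℂ} (huv : ∀ j, IsReflection a γ (u j) (v j))
    (hγ : ∀ t : ℕ, R (a δ) (I * a δ / 2 - 2 * γ - t * (2 * step a δ)) ≠ 0) :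
    Reverses a ha δ u v := by
  set s := step a δ with hs
  have c1 := countable_not_gridGeneric ha δ
  have c2 : {y | ∃ i : ℤ, R (a δ) (2 * y + (I * a δ / 2 + i * (2 * s))) = 0}.Countable :=
    countable_setOf_exists_int fun i => countable_R_affine (ha δ) two_ne_zero _
  refine reverses_of_gridKernels ha δ (c1.union c2) fun y₀ hy₀ e he h => ?_
  simp only [Set.mem_union, Set.mem_ofPred_eq, not_or, not_not, not_exists] at hy₀
  obtain ⟨hy, hy2⟩ := hy₀
  obtain ⟨c, hc⟩ := exists_of_mem_evalSpan he
  suffices c = 0 by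
    ext f; rw [hc, this]; simp
  by_contra hne
  have hsupp : c.support.Nonempty := Finsupp.support_nonempty_iff.2 hne
  set i := c.support.min' hsupp with hi
  -- The ratio of successive entries of row i, as the second index grows by two.
  set q : ℕ → ℂ → ℂ := fun r x =>
    R (a δ) (x - y₀ - (2 * r + 1) * s + γ) * R (a δ) (x + y₀ + (2 * i + 2 * r + 1) * s - γ) /
      (R (a δ) (x - y₀ - (2 * r + 1) * s - γ) * R (a δ) (x + y₀ + (2 * i + 2 * r + 1) * s + γ))
    with hq
  set Q : ℤ → ℂ → ℂ := fun k x =>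
    if Even (k - i) then ∏ r ∈ Finset.range ((k - i) / 2).toNat, q r x else 0 with hQ
  -- Chosen so that the numerator of q₀ is R(ia_δ/2) = 0; `hγ` says that no denominator involving x
  -- - y₀ vanishes there.
  set x₁ := y₀ + s - γ + I * a δ / 2 with hx₁
  have hRc := (differentiable_R (ha δ)).continuous
  have hqc : ∀ r, ContinuousAt (q r) x₁ := by
    intro r
    refine ContinuousAt.div (Continuous.continuousAt ?_) (Continuous.continuousAt ?_)
      (mul_ne_zero ?_ ?_)
    · exact (hRc.comp (by fun_prop)).mul (hRc.comp (by fun_prop))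
    · exact (hRc.comp (by fun_prop)).mul (hRc.comp (by fun_prop))
    · convert hγ r using 2
      rw [hx₁]; ring
    · convert hy2 (i + r + 1) using 2
      rw [hx₁]; push_cast; ring
  have hQc : ∀ k, ContinuousAt (Q k) x₁ := by
    intro k
    by_cases hp : Even (k - i)
    · simp only [hQ, hp, if_true]
      exact tendsto_finsetProd _ fun r _ => hqc r
    · simp only [hQ, hp, if_false]
      exact continuousAt_const
  have hq0 : q 0 x₁ = 0 := by
    simp only [hq]
    rw [show x₁ - y₀ - (2 * (0 : ℕ) + 1) * s + γ = I * a δ / 2 by rw [hx₁]; push_cast; ring,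
      R_half (ha δ), zero_mul, zero_div]
  have hQi : ∀ x, Q i x = 1 := fun x => by simp [hQ]
  have hQ0 : ∀ k, i < k → Q k x₁ = 0 := by
    intro k hk
    by_cases hp : Even (k - i)
    · simp only [hQ, hp, if_true]
      obtain ⟨d, hd⟩ := hp
      exact Finset.prod_eq_zero (i := 0) (Finset.mem_range.2 (by omega)) hq0
    · simp only [hQ, hp, if_false]
  set S : ℂ → ℂ := fun x => ∑ k ∈ c.support, c k * Q k x with hS
  have hSc : ContinuousAt S x₁ :=
    tendsto_finsetSum _ fun k _ => continuousAt_const.mul (hQc k)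
  have d1 : {x | ∃ t : ℤ, R (a δ) (1 * x + (-y₀ + (2 * t - 1) * s - γ)) = 0}.Countable :=
    countable_setOf_exists_int fun t => countable_R_affine (ha δ) one_ne_zero _
  have d2 : {x | ∃ t : ℤ, R (a δ) (1 * x + (-y₀ + (2 * t - 1) * s + γ)) = 0}.Countable :=
    countable_setOf_exists_int fun t => countable_R_affine (ha δ) one_ne_zero _
  have d3 : {x | ∃ M : ℤ, R (a δ) (1 * x + (y₀ + (2 * M - 1) * s - γ)) = 0}.Countable :=
    countable_setOf_exists_int fun t => countable_R_affine (ha δ) one_ne_zero _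
  have d4 : {x | ∃ M : ℤ, R (a δ) (1 * x + (y₀ + (2 * M - 1) * s + γ)) = 0}.Countable :=
    countable_setOf_exists_int fun t => countable_R_affine (ha δ) one_ne_zero _
  have hcount := (((c1.union d1).union d2).union d3).union d4
  -- The kernel with nonvanishing D and H is unavailable at x₁ itself; S vanishes at nearby z₀ off a
  -- countable set, and continuity gives the value at x₁.
  have hS0 : S x₁ = 0 := by
    obtain ⟨B, hB, hcount⟩ : ∃ B : Set ℂ, B = _ ∧ B.Countable := ⟨_, rfl, hcount⟩
    have hmem := (dense_compl_of_countable hcount) x₁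
    rw [mem_closure_iff_nhdsWithin_neBot] at hmem
    refine tendsto_nhds_unique (hSc.tendsto.mono_left (nhdsWithin_le_nhds (s := Bᶜ)))
      (tendsto_const_nhds.congr' ?_)
    filter_upwards [self_mem_nhdsWithin] with z₀ hz₀
    simp only [hB, Set.mem_compl_iff, Set.mem_union, Set.mem_ofPred_eq, not_or, not_not, not_exists,
      one_mul] at hz₀
    obtain ⟨⟨⟨⟨hz, g1⟩, g2⟩, g3⟩, g4⟩ := hz₀
    obtain ⟨D, hD0, hD⟩ := exists_recursion
      (r := fun t => R (a δ) (z₀ + (-y₀ + (2 * (t + 1 : ℤ) - 1) * s - γ)) /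
        R (a δ) (z₀ + (-y₀ + (2 * (t + 1 : ℤ) - 1) * s + γ)))
      fun t => div_ne_zero (g1 _) (g2 _)
    obtain ⟨H, hH0, hH⟩ := exists_recursion
      (r := fun M => R (a δ) (z₀ + (y₀ + (2 * (M + 1 : ℤ) - 1) * s - γ)) /
        R (a δ) (z₀ + (y₀ + (2 * (M + 1 : ℤ) - 1) * s + γ)))
      fun M => div_ne_zero (g3 _) (g4 _)
    have hD' : ∀ t, D t = R (a δ) (z₀ + (-y₀ + (2 * t - 1) * s - γ)) /
        R (a δ) (z₀ + (-y₀ + (2 * t - 1) * s + γ)) * D (t - 1) := by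
      intro t
      simpa only [sub_add_cancel] using hD (t - 1)
    have hH' : ∀ M, H M = R (a δ) (z₀ + (y₀ + (2 * M - 1) * s - γ)) /
        R (a δ) (z₀ + (y₀ + (2 * M - 1) * s + γ)) * H (M - 1) := by
      intro M
      simpa only [sub_add_cancel] using hH (M - 1)
    have hker := h z₀ (productKernel D H) hz (fun j => by
      refine isGridKernel_productKernel fun t M z y hzt hyt => ?_
      rw [← hs] at hzt hyt
      have hzr : CoeffRegular a δ z := by rw [hzt]; exact hz.1 _
      have hyr : CoeffRegular a δ y := by rw [hyt]; exact hy.1 _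
      have hu : z₀ + (y₀ + (2 * M - 1) * s) = z + y := by rw [hzt, hyt]; push_cast; ring
      have hv : z₀ + (-y₀ + (2 * t - 1) * s) = z - y := by rw [hzt, hyt]; push_cast; ring
      have e1 := hH' M
      have e2 := hD' t
      have e3 := g4 M
      have e4 := g2 t
      have hu₁ : z₀ + (y₀ + (2 * M - 1) * s - γ) = z + y - γ := by linear_combination hu
      have hu₂ : z₀ + (y₀ + (2 * M - 1) * s + γ) = z + y + γ := by linear_combination hu
      have hv₁ : z₀ + (-y₀ + (2 * t - 1) * s - γ) = z - y - γ := by linear_combination hv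
      have hv₂ : z₀ + (-y₀ + (2 * t - 1) * s + γ) = z - y + γ := by linear_combination hv
      rw [hu₁, hu₂] at e1
      rw [hv₁, hv₂] at e2
      rw [hu₂] at e3
      rw [hv₂] at e4
      exact four_term_of_ratio ha δ (huv j) hzr hyr rfl rfl e3 e4 e1 e2) i
    have hratio : ∀ d : ℕ, D (-d) * H (i + d) =
        D 0 * H i * ∏ r ∈ Finset.range d, q r z₀ := by
      intro d
      induction d with
      | zero => simp
      | succ d ih =>
        rw [Finset.prod_range_succ, ← mul_assoc, ← ih]
        have e1 := hD' (-d)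
        have e2 := hH (i + d)
        have e3 := g1 (-d)
        have e4 := g2 (-d)
        rw [show (-(d + 1 : ℕ) : ℤ) = -d - 1 by push_cast; ring,
          show i + ((d + 1 : ℕ) : ℤ) = i + d + 1 by push_cast; ring, e2, e1]
        have f1 : z₀ + (-y₀ + (2 * ((-d : ℤ) : ℂ) - 1) * s - γ) =
          z₀ - y₀ - (2 * d + 1) * s - γ := by push_cast; ring
        have f2 : z₀ + (-y₀ + (2 * ((-d : ℤ) : ℂ) - 1) * s + γ) =
          z₀ - y₀ - (2 * d + 1) * s + γ := by push_cast; ring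
        have f3 : z₀ + (y₀ + (2 * ((i + d + 1 : ℤ) : ℂ) - 1) * s - γ) =
          z₀ + y₀ + (2 * i + 2 * d + 1) * s - γ := by push_cast; ring
        have f4 : z₀ + (y₀ + (2 * ((i + d + 1 : ℤ) : ℂ) - 1) * s + γ) =
          z₀ + y₀ + (2 * i + 2 * d + 1) * s + γ := by push_cast; ring
        simp only [hq]
        rw [f1] at e3
        rw [f2] at e4
        rw [f1, f2, f3, f4]
        have e5 := g4 (i + d + 1)
        rw [f4] at e5
        generalize R (a δ) (z₀ - y₀ - (2 * d + 1) * s - γ) = p1 at *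
        generalize R (a δ) (z₀ - y₀ - (2 * d + 1) * s + γ) = p2 at *
        generalize R (a δ) (z₀ + y₀ + (2 * i + 2 * d + 1) * s - γ) = p3 at *
        generalize R (a δ) (z₀ + y₀ + (2 * i + 2 * d + 1) * s + γ) = p4 at *
        field_simp
    rw [hc] at hker
    have hsum : ∑ k ∈ c.support, c k * productKernel D H i k = D 0 * H i * S z₀ := by
      rw [hS, Finset.mul_sum]
      refine Finset.sum_congr rfl fun k hk => ?_
      have hik : i ≤ k := c.support.min'_le k hk
      by_cases hp : Even (k - i)
      · obtain ⟨d, hd⟩ : ∃ d : ℕ, k = i + 2 * d := by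
          obtain ⟨d, hd⟩ := hp
          exact ⟨d.toNat, by omega⟩
        have e1 := productKernel_even D H (-d) k
        rw [show k + 2 * (-(d : ℤ)) = i by omega, show k + (-(d : ℤ)) = i + d by omega,
          hratio] at e1
        have e2 : Q k z₀ = ∏ r ∈ Finset.range d, q r z₀ := by
          simp only [hQ, hp, if_true]
          rw [show ((k - i) / 2).toNat = d by omega]
        rw [e1, e2]
        ring
      · have : ¬Even (i - k) := by
          rw [Int.even_iff] at hp ⊢
          omega
        rw [productKernel_odd D H this]
        simp only [hQ, hp, if_false, mul_zero]
    rw [hsum] at hker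
    exact ((mul_eq_zero.1 hker).resolve_left (mul_ne_zero (hD0 0) (hH0 i))).symm
  have hSi : S x₁ = c i := by
    simp only [hS]
    rw [Finset.sum_eq_single i, hQi, mul_one]
    · intro k hk hki
      rw [hQ0 k (lt_of_le_of_ne (c.support.min'_le k hk) (Ne.symm hki)), mul_zero]
    · intro hn; exact absurd (c.support.min'_mem hsupp) hn
  exact Finsupp.mem_support_iff.1 (c.support.min'_mem hsupp) (hSi.symm.trans hS0)

theorem isReflection_neg {a : Bool → ℂ} {γ : ℂ} {l l' : Fin 4 → ℂ} (h : IsReflection a γ l l') :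
    IsReflection a (I * (a true + a false) - γ) (-l) (-l') := by
  obtain ⟨⟨m, hm⟩, hk⟩ := h
  refine ⟨⟨-m, ?_⟩, fun n => ?_⟩
  · simp only [Pi.neg_apply, Finset.sum_neg_distrib]
    push_cast
    linear_combination -hm
  · obtain ⟨k, hk⟩ := hk n
    refine ⟨-k, ?_⟩
    rw [Pi.neg_apply, Pi.neg_apply, hk]
    push_cast
    ring

/-- If γ is resonant, negation replaces it by i(a₊ + a₋) - γ, for which the finite kernel exists;
conjugating by `reverses_neg` returns to the original parameters. -/
theorem reverses_of_isReflection {J : Type*} {a : Bool → ℂ} (ha : ∀ δ, 0 < (a δ).re) (δ : Bool)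
    {u v : J → Fin 4 → ℂ} {γ : ℂ} (huv : ∀ j, IsReflection a γ (u j) (v j)) :
    Reverses a ha δ u v := by
  classical
  by_cases hγ : ∀ t : ℕ, R (a δ) (I * a δ / 2 - 2 * γ - t * (2 * step a δ)) ≠ 0
  · exact reverses_of_nonresonant ha δ huv hγ
  have hneg : Reverses a ha δ (fun j => -u j) (fun j => -v j) := by
    push Not at hγ
    obtain ⟨t, ht⟩ := hγ
    obtain ⟨m, n, hmn⟩ := exists_of_R_eq_zero (ha δ) ht
    set γ' := I * (a true + a false) - γ with hγ'
    have hex : ∃ k : ℕ, ∃ m n : ℤ,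
        2 * γ' = (k + 1) * (2 * step a δ) + (m + n * (I * a δ)) := by
      -- Subtracting 2γ from 2i(a₊ + a₋) contributes 2·(2s), hence k + 1 = t + 2, and two further
      -- periods ia_δ.
      refine ⟨t + 1, m, n + 2, ?_⟩
      rw [hγ', add_not a δ]
      have hst : I * a (!δ) = 2 * step a δ := by rw [step]; ring
      push_cast
      linear_combination hmn + 2 * hst
    -- Minimality of k gives the nonvanishing of the inner denominators: a zero at r would make 2rs
    -- a lattice point, and k - r would also work.
    obtain ⟨m', n', hk⟩ := Nat.find_spec hex
    refine reverses_of_finite_kernel ha δ (fun j => isReflection_neg (huv j)) hk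
      fun r hr1 hr2 h0 => ?_
    obtain ⟨m₀, n₀, h0⟩ := exists_of_R_eq_zero (ha δ) h0
    refine Nat.find_min hex (m := Nat.find hex - r) (by omega) ⟨m' + m₀, n' + n₀, ?_⟩
    rw [Nat.cast_sub hr2]
    push_cast
    linear_combination hk + h0
  have := (reverses_neg ha δ u).trans_trans hneg (reverses_neg ha δ _)
  simpa only [neg_neg] using this

/-! ### The representations -/

theorem generator_eq_of_int {a : Bool → ℂ} (ha : ∀ δ, 0 < (a δ).re) (δ : Bool) {l l' : Fin 4 → ℂ}
    (h : ∀ n, ∃ k : ℤ, l' n = l n + k) : generator a ha δ l' = generator a ha δ l := by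
  have : actLinear a ha δ l' = actLinear a ha δ l := by
    refine LinearMap.ext fun f => Subtype.ext (funext fun z => ?_)
    simp only [actLinear, act, LinearMap.coe_mk, AddHom.coe_mk, coeff_eq_of_int h]
  unfold generator
  congr 1

/-- The parameters whose entries sum to `s` modulo `2`. -/
abbrev ParamMod (s : ℂ) : Type := {l : Fin 4 → ℂ // ∃ m : ℤ, ∑ n, l n = s + 2 * m}

theorem representation_eq_adjoin_range {a : Bool → ℂ} (ha : ∀ δ, 0 < (a δ).re) (δ : Bool) (s : ℂ) :
    representation a ha δ (multiplier a s) =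
      Algebra.adjoin ℂ (Set.range fun l : ParamMod s => generator a ha δ l.1) := by
  unfold representation
  congr 1
  ext A
  constructor
  · rintro ⟨l, hl, rfl⟩
    rw [multiplier, multiplier, exp_eq_exp_iff_exists_int] at hl
    obtain ⟨k, hk⟩ := hl
    have hs : ∑ n, l n = s - k := by
      apply mul_left_cancel₀ two_pi_I_ne_zero
      linear_combination -hk
    -- The multiplier fixes ∑ l_n only modulo 1; an integer shift of one coordinate corrects the sum
    -- without changing the operator.
    refine ⟨⟨fun n => l n + ((if n = 0 then k else 0 : ℤ) : ℂ), 0, ?_⟩, ?_⟩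
    · rw [Finset.sum_add_distrib, hs]
      simp
    · exact generator_eq_of_int ha δ fun n => ⟨_, rfl⟩
  · rintro ⟨⟨l, m, hl⟩, rfl⟩
    refine ⟨l, ?_, rfl⟩
    rw [multiplier, multiplier, hl, exp_eq_exp_iff_exists_int]
    refine ⟨-(2 * m), ?_⟩
    push_cast
    ring

theorem extendsToReversal_of {a : Bool → ℂ} (ha : ∀ δ, 0 < (a δ).re) (δ : Bool) {s γ : ℂ}
    {φ : (Fin 4 → ℂ) → (Fin 4 → ℂ)} (hsum : ∀ l, (∃ m : ℤ, ∑ n, l n = s + 2 * m) →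
      ∃ m : ℤ, ∑ n, φ l n = s + 2 * m)
    (hφ : ∀ l, (∃ m : ℤ, ∑ n, l n = s + 2 * m) → IsReflection a γ l (φ l)) :
    ExtendsToReversal a ha δ s φ := by
  obtain ⟨Φ, h1, h2, h3, h4⟩ := exists_reversal
    (fun l : ParamMod s => generator a ha δ l.1) (fun l => ⟨φ l.1, hsum l.1 l.2⟩)
    (fun l => generator_eq_of_int ha δ fun n => by
      obtain ⟨k, hk⟩ := (hφ l.1 l.2).2 n
      obtain ⟨k', hk'⟩ := (hφ _ (hsum l.1 l.2)).2 n
      refine ⟨k' - k, ?_⟩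
      change φ (φ l.1) n = _
      rw [hk', hk]
      push_cast
      ring)
    (reverses_of_isReflection ha δ (u := fun l : ParamMod s => l.1) (v := fun l => φ l.1)
      fun l => hφ l.1 l.2)
    (representation_eq_adjoin_range ha δ s)
  exact ⟨Φ, h1, h2, h3, fun l hl X hX => h4 ⟨l, hl⟩ X hX⟩

theorem sum_phi1 (l : Fin 4 → ℂ) : ∑ n, phi1 l n = ∑ n, l n := by
  simp only [phi1, Fin.sum_univ_four]; ring

theorem sum_phi2 (l : Fin 4 → ℂ) : ∑ n, phi2 l n = (∑ n, l n) + 2 := by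
  simp only [phi2, phi1, Fin.sum_univ_four]; ring

theorem extendsToReversal_phi1 {a : Bool → ℂ} (ha : ∀ δ, 0 < (a δ).re) (δ : Bool) (s : ℂ) :
    ExtendsToReversal a ha δ s phi1 := by
  refine extendsToReversal_of ha δ (γ := (I * (a true + a false) + s) / 2) ?_ ?_
  · rintro l ⟨m, hm⟩
    exact ⟨m, by rw [sum_phi1, hm]⟩
  · rintro l ⟨m, hm⟩
    refine isReflection_phi1_of_even (m := -(2 * m)) ?_ ⟨-m, by ring⟩
    push_cast
    linear_combination -hm

theorem extendsToReversal_phi2 {a : Bool → ℂ} (ha : ∀ δ, 0 < (a δ).re) (δ : Bool) (s : ℂ) :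
    ExtendsToReversal a ha δ s phi2 := by
  -- The extra 1/2 in γ makes m odd for every l with ∑ l_n in s + 2ℤ, which is the case of `phi2`.
  refine extendsToReversal_of ha δ (γ := (I * (a true + a false) + s + 1) / 2) ?_ ?_
  · rintro l ⟨m, hm⟩
    exact ⟨m + 1, by rw [sum_phi2, hm]; push_cast; ring⟩
  · rintro l ⟨m, hm⟩
    refine isReflection_phi2_of_odd (m := -(2 * m) + 1) ?_ ⟨-m, by ring⟩
    push_cast
    linear_combination -hm

end SklyaninKernel

end

theorem corollary4p2 (a : Bool → ℂ) (ha : ∀ δ, 0 < (a δ).re) :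
    (∀ (l : Fin 4 → ℂ) (γ : ℂ) (m : ℤ),
      2 * γ = Complex.I * (a true + a false) + (∑ n, l n) + m → ∀ δ : Bool,
        (Even m →
          SklyaninKernel.KernelIdentity a δ l (SklyaninKernel.phi1 l) γ ∧
          SklyaninKernel.KernelIdentity a δ l (SklyaninKernel.phi2 l) (γ + 1 / 2)) ∧
        (Odd m →
          SklyaninKernel.KernelIdentity a δ l (SklyaninKernel.phi2 l) γ ∧
          SklyaninKernel.KernelIdentity a δ l (SklyaninKernel.phi1 l) (γ + 1 / 2))) ∧
    (∀ (δ : Bool) (s : ℂ),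
      SklyaninKernel.ExtendsToReversal a ha δ s SklyaninKernel.phi1 ∧
      SklyaninKernel.ExtendsToReversal a ha δ s SklyaninKernel.phi2) :=
  ⟨fun l γ m h δ => SklyaninKernel.kernelIdentities ha l γ m h δ,
    fun δ s => ⟨SklyaninKernel.extendsToReversal_phi1 ha δ s,
      SklyaninKernel.extendsToReversal_phi2 ha δ s⟩⟩
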